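/- Conventions. Let $G$ be a groupoid with set of objects $X=O_G$, initial and final point maps $\alpha,\beta\colon G\to X$, identities $1_x$, and product $ab$ defined when $\beta(a)=\alpha(b)$. It is a topological groupoid if $G$ and $X$ carry topologies for which $\alpha$, $\beta$, $x\mapsto 1_x$, the inversion and the partial multiplication are continuous. The star $G_x=\{a\in G:\alpha(a)=x\}$ has the subspace topology; for $W\subseteq G$ put $W_x=W\cap G_x$ and $W^2=\{ab : a,b\in W,\ \beta(a)=\alpha(b)\}$. A topological groupoid $G$ is compatible locally trivial if it is equipped with a base $\{U_i\}_{i\in I}$ of the topology of $X$ and, for all $i$ and all $x\in U_i$, a continuous local section $s_{x,i}\colon U_i\to G_x$ of $\beta$ (so $\beta s_{x,i}(y)=y$ for $y\in U_i$) with $s_{x,i}(x)=1_x$, such that whenever $x\in U_i\cap U_j$ there is $k$ with $x\in U_k\subseteq U_i\cap U_j$ and $s_{x,i}|_{U_k}=s_{x,j}|_{U_k}$. A universal covering is a surjective covering map with simply connected total space. A subset $U$ of a space $B$ is liftable if it is open and path-connected and the inclusion $U\to B$ induces the trivial map on each fundamental group of $U$. For $W\subseteq G$ containing all identities, the monodromy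 groupoid is $M(G,W)=F(W)/N$, where $F(W)$ is the free groupoid on the graph $W$ (with vertex set $X$ and generators $[a]$, $a\in W$) and $N$ is its normal subgroupoid generated by the elements $[a][b][ab]^{-1}$ for $a,b\in W$ such that $ab$ is defined and $ab\in W$. It has the set of objects $X$, and $p\colon M(G,W)\to G$ is the canonical morphism, which is the identity on objects and is induced by the inclusion $W\to G$. Theorem. Let $G$ be a compatible locally trivial topological groupoid such that each star $G_x$ has a universal covering. Let $W$ be an open subset of $G$ with $O_G\subseteq W$ (that is, $1_x\in W$ for all $x\in X$), such that each $W_x$ is path-connected and $W^2$ is contained in an open neighbourhood $V$ of $O_G$ with each star $V_x$ liftable in $G_x$. Suppose that each local section $s_{x,i}\colon U_i\to G_x$ has image in $W$. Then there is a topology on $M(G,W)$ which makes it a topological groupoid over the space of objects $X$ (with its given topology) and for which, for each $x\in X$, the restriction $p\colon M(G,W)_x\to G_x$ of the canonical morphism is a universal covering of $G_x$, where $M(G,W)_x$ has the subspace topology. -/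

import Mathlib

open CategoryTheory Topology

universe u v w

-- Without this line the quiver of a category is found through `ReflQuiver`.
attribute [local instance 2000] CategoryStruct.toQuiver

/-! ### Topological groupoids

A groupoid on the set of objects `X` is `[Groupoid X]`. Its set of elements is `Quiver.Total X`,
with initial point `a.left` and final point `a.right`; the product `ab`
(defined when `β a = α b`) is `a ≫ b`. -/

namespace TopGpd

section Elements

variable {X : Type u} [Groupoid.{v} X]

/-- The identity `1_x`, as an element of the groupoid. -/
def one (x : X) : Quiver.Total X := ⟨x, x, 𝟙 x⟩

/-- The inverse of an element. -/
def inv (a : Quiver.Total X) : Quiver.Total X := ⟨a.right, a.left, Groupoid.inv a.hom⟩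

/-- The product `ab` of two elements with `β a = α b`. -/
def mul (a b : Quiver.Total X) (h : a.right = b.left) : Quiver.Total X :=
  ⟨a.left, b.right, a.hom ≫ eqToHom h ≫ b.hom⟩

/-- The star `G_x`: all elements with initial point `x`. When the set of elements carries a
topology, this is given the subspace topology. -/
abbrev Star (x : X) : Type (max u v) := {a : Quiver.Total X // a.left = x}

/-- The part `W_x = W ∩ G_x` of a set `W` of elements in the star at `x`. -/
def starPart (W : Set (Quiver.Total X)) (x : X) : Set (Star x) := {a | a.1 ∈ W}

/-- `W²`: all products `ab` that are defined, with `a, b ∈ W`. -/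
def square (W : Set (Quiver.Total X)) : Set (Quiver.Total X) :=
  {c | ∃ (a b : Quiver.Total X) (h : a.right = b.left), a ∈ W ∧ b ∈ W ∧ c = mul a b h}

/-- The map of elements induced by a morphism of groupoids. -/
def mapTotal {Y : Type*} [Groupoid Y] (F : X ⥤ Y) (a : Quiver.Total X) : Quiver.Total Y :=
  ⟨F.obj a.left, F.obj a.right, F.map a.hom⟩

/-- The map of stars induced by a morphism of groupoids. -/
def mapStar {Y : Type*} [Groupoid Y] (F : X ⥤ Y) (x : X) (a : Star x) : Star (F.obj x) :=
  ⟨mapTotal F a.1, congrArg F.obj a.2⟩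

end Elements

/-- A topological groupoid: the sets of objects and of elements have topologies for which all
the structure maps are continuous. -/
class IsTopologicalGroupoid (X : Type u) [Groupoid.{v} X] [TopologicalSpace X]
    [TopologicalSpace (Quiver.Total X)] : Prop where
  continuous_source : Continuous (fun a : Quiver.Total X => a.left)
  continuous_target : Continuous (fun a : Quiver.Total X => a.right)
  continuous_one : Continuous (one : X → Quiver.Total X)
  continuous_inv : Continuous (inv : Quiver.Total X → Quiver.Total X)
  continuous_mul : Continuous
    (fun p : {p : Quiver.Total X × Quiver.Total X // p.1.right = p.2.left} =>
      mul p.1.1 p.1.2 p.2)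

/-- The data that make a topological groupoid compatible locally trivial: a base `U i` of the
topology on the objects and, whenever `x ∈ U i`, a local section `s i x : U i → G_x` of the
final point map with `s i x x = 1_x`, such that any two local sections about `x` agree on some
basic neighbourhood of `x`. The values of `s i x` are relevant only on `U i` and for `x ∈ U i`. -/
structure CompatibleLocalSections (X : Type u) [Groupoid.{v} X] [TopologicalSpace X]
    [TopologicalSpace (Quiver.Total X)] (ι : Type w) where
  U : ι → Set X
  isBasis : TopologicalSpace.IsTopologicalBasis (Set.range U)
  s : ι → X → X → Quiver.Total X
  source_s : ∀ i, ∀ x ∈ U i, ∀ y ∈ U i, (s i x y).left = x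
  target_s : ∀ i, ∀ x ∈ U i, ∀ y ∈ U i, (s i x y).right = y
  s_self : ∀ i, ∀ x ∈ U i, s i x x = one x
  continuousOn_s : ∀ i, ∀ x ∈ U i, ContinuousOn (s i x) (U i)
  compatible : ∀ i j, ∀ x ∈ U i ∩ U j, ∃ k, x ∈ U k ∧ U k ⊆ U i ∩ U j ∧
    ∀ y ∈ U k, s i x y = s j x y

/-! ### Coverings -/

/-- A universal covering: a surjective covering map with simply connected total space. -/
structure IsUniversalCovering {E : Type*} {B : Type*} [TopologicalSpace E] [TopologicalSpace B]
    (q : E → B) : Prop where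
  isCoveringMap : IsCoveringMap q
  surjective : Function.Surjective q
  simplyConnected : SimplyConnectedSpace E

/-- `B` has a universal covering. -/
def HasUniversalCovering (B : Type u) [TopologicalSpace B] : Prop :=
  ∃ (E : Type u) (_ : TopologicalSpace E) (q : E → B), IsUniversalCovering q

/-- A liftable subset: open, path-connected, and each loop in it is null-homotopic in the whole
space (the inclusion maps each fundamental group trivially). -/
structure IsLiftable {B : Type*} [TopologicalSpace B] (S : Set B) : Prop where
  isOpen : IsOpen S
  isPathConnected : IsPathConnected S
  null_homotopic : ∀ (b : S) (γ : Path b b),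
    (γ.map continuous_subtype_val).Homotopic (Path.refl (b : B))

/-! ### The monodromy groupoid -/

section Monodromy

variable {X : Type u} [Groupoid.{v} X] (W : Set (Quiver.Total X))

/-- The graph `W`: its vertices are the objects of the groupoid, its edges the elements
of `W`. -/
structure Graph (W : Set (Quiver.Total X)) : Type u where
  base : X

instance : Quiver.{v} (Graph W) where
  Hom x y := {a : x.base ⟶ y.base // (⟨x.base, y.base, a⟩ : Quiver.Total X) ∈ W}

/-- The free groupoid `F(W)` on the graph `W`. -/
abbrev Free : Type u := Quiver.FreeGroupoid (Graph W)

/-- The element `[a]` of the free groupoid, for `a ∈ W`. -/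
def bracket {x y : X} (a : x ⟶ y) (ha : (⟨x, y, a⟩ : Quiver.Total X) ∈ W) :
    (Quiver.FreeGroupoid.of (Graph W)).obj ⟨x⟩ ⟶ (Quiver.FreeGroupoid.of (Graph W)).obj ⟨y⟩ :=
  (Quiver.FreeGroupoid.of (Graph W)).map (X := ⟨x⟩) (Y := ⟨y⟩) ⟨a, ha⟩

/-- The elements `[a][b][ab]⁻¹` for `a, b ∈ W` such that `ab` is defined and lies in `W`. -/
inductive Relator : ∀ c d : Free W, Set (c ⟶ d)
  | mk {x y z : X} (a : x ⟶ y) (b : y ⟶ z) (ha : (⟨x, y, a⟩ : Quiver.Total X) ∈ W)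
      (hb : (⟨y, z, b⟩ : Quiver.Total X) ∈ W) (hab : (⟨x, z, a ≫ b⟩ : Quiver.Total X) ∈ W) :
      Relator _ _ (bracket W a ha ≫ bracket W b hb ≫ Groupoid.inv (bracket W (a ≫ b) hab))

/-- The normal subgroupoid `N` of `F(W)` generated by the elements `[a][b][ab]⁻¹`. -/
def normalSubgroupoid : Subgroupoid (Free W) := Subgroupoid.generatedNormal (Relator W)

/-- Congruence modulo `N` on the parallel elements of `F(W)`. -/
def modN : HomRel (Free W) :=
  fun c _ f g => f ≫ Groupoid.inv g ∈ (normalSubgroupoid W).arrows c c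

/-- The monodromy groupoid `M(G,W) = F(W)/N`. It has the same objects as `G`; the wrapper makes
its groupoid structure a different instance. -/
structure Monodromy (W : Set (Quiver.Total X)) : Type u where
  base : X

/-- The object `x` of `M(G,W)`, as an object of the quotient category `F(W)/N`. -/
def Monodromy.toQuotient (x : Monodromy W) : CategoryTheory.Quotient (modN W) :=
  ⟨(Quiver.FreeGroupoid.of (Graph W)).obj ⟨x.base⟩⟩

instance : Groupoid (Monodromy W) where
  Hom x y := x.toQuotient W ⟶ y.toQuotient W
  id x := 𝟙 (x.toQuotient W)
  comp f g := CategoryStruct.comp (obj := CategoryTheory.Quotient (modN W)) f g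
  id_comp f := Category.id_comp (obj := CategoryTheory.Quotient (modN W)) f
  comp_id f := Category.comp_id (obj := CategoryTheory.Quotient (modN W)) f
  assoc f g h := Category.assoc (obj := CategoryTheory.Quotient (modN W)) f g h
  inv f := Groupoid.inv (obj := CategoryTheory.Quotient (modN W)) f
  inv_comp f := Groupoid.inv_comp (obj := CategoryTheory.Quotient (modN W)) f
  comp_inv f := Groupoid.comp_inv (obj := CategoryTheory.Quotient (modN W)) f

/-- The objects of `M(G,W)` are those of `G`, with the same topology. -/
instance [TopologicalSpace X] : TopologicalSpace (Monodromy W) :=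
  TopologicalSpace.induced Monodromy.base inferInstance

/-- The inclusion of the graph `W` in `G`. -/
def inclusion : Graph W ⥤q X where
  obj x := x.base
  map a := a.1

/-- The morphism `F(W) → G` given by the inclusion of `W`. -/
def freeToBase : Free W ⥤ X := Quiver.FreeGroupoid.lift (inclusion W)

theorem freeToBase_bracket {x y : X} (a : x ⟶ y) (ha : (⟨x, y, a⟩ : Quiver.Total X) ∈ W) :
    (freeToBase W).map (bracket W a ha) = a := by
  change (𝟙 x ≫ a : x ⟶ y) = a
  exact Category.id_comp a

theorem freeToBase_modN (c d : Free W) (f g : c ⟶ d) (h : modN W f g) :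
    (freeToBase W).map f = (freeToBase W).map g := by
  have hN : normalSubgroupoid W ≤ Subgroupoid.ker (freeToBase W) := by
    refine ((Subgroupoid.ker_isNormal (freeToBase W)).generatedNormal_le (Relator W)).2 ?_
    rintro _ _ _ ⟨a, b, ha, hb, hab⟩
    rw [Subgroupoid.mem_ker_iff]
    refine ⟨rfl, ?_⟩
    have key : (freeToBase W).map (bracket W a ha ≫ bracket W b hb) =
        (freeToBase W).map (bracket W (a ≫ b) hab) := by
      rw [Functor.map_comp, freeToBase_bracket, freeToBase_bracket, freeToBase_bracket]
      rfl
    rw [← Category.assoc, Functor.map_comp, key, ← Functor.map_comp, Groupoid.comp_inv,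
      CategoryTheory.Functor.map_id]
    rfl
  have h' : f ≫ Groupoid.inv g ∈ (Subgroupoid.ker (freeToBase W)).arrows c c :=
    (Subgroupoid.le_iff _ _).1 hN h
  rw [Subgroupoid.mem_ker_iff] at h'
  obtain ⟨_, h'⟩ := h'
  rw [eqToHom_refl, Functor.map_comp, Groupoid.inv_eq_inv, Functor.map_inv,
    IsIso.comp_inv_eq, Category.id_comp] at h'
  exact h'

/-- The canonical morphism `p : M(G,W) → G`, the identity on objects, with `p [a] = a` for
`a ∈ W`. -/
def canonical : Monodromy W ⥤ X where
  obj x := x.base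
  map {x y} f := (CategoryTheory.Quotient.lift (modN W) (freeToBase W) (freeToBase_modN W)).map
    (X := x.toQuotient W) (Y := y.toQuotient W) f
  map_id x := (CategoryTheory.Quotient.lift (modN W) (freeToBase W)
    (freeToBase_modN W)).map_id (x.toQuotient W)
  map_comp {x y z} f g := (CategoryTheory.Quotient.lift (modN W) (freeToBase W)
    (freeToBase_modN W)).map_comp (X := x.toQuotient W) (Y := y.toQuotient W)
    (Z := z.toQuotient W) f g

end Monodromy

end TopGpd

/-! Write `[a]` for the element `br W a` of `M(G,W)`. The map `a ↦ [a]` is a section of `p` over `W`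
and is multiplicative as long as products stay in `W`.

Topology. An element near `u` should be `[e] u [f]` with `e`, `f` close to identities. For `g` near
`p u`, a local section gives a factorisation `g = e (p u) f`, hence a candidate `localLift` at `u`.
Two factorisations differ by a small loop `k` at the initial point of `u`, and small loops can be
moved across `u`: `[k] u = u [(p u)⁻¹ k (p u)]` (`eventually_br_mul_comm`, by induction on a word
for `u`). So the choice is immaterial (`eventually_eq_of_small`), the local lifts are coherent and
define a topology (`nhds_monodromy`), and the same exchange makes the multiplication continuous.

Covering. Over the translate `aW` of a star, `(g, u) ↦ u [a⁻¹ g]` trivialises `p`. The image of `p`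
is open and closed in a connected star.

Simple connectedness. Elements of `W` generate, and each is joined to an identity inside `W`, so the
stars of `M(G,W)` are path-connected. Let `q : E → G_x` be a universal covering. An element `w` of
`W` moves a point `e` of `E` along the lift of a path in `q(e)W` from `q(e)` to `q(e)w`. Liftability
of `V` makes this independent of the path, and `W² ⊆ V` makes it respect the relations, so `M(G,W)`
acts. The orbit of a point over `1_x` gives a map `Θ : M(G,W)_x → E` over `G_x`
(`exists_lift_star`). For a loop `γ` in `M(G,W)_x` the lift of `p γ` to `E` is `Θ ∘ γ`, hence
closed, hence null-homotopic. So `p γ` is null-homotopic, and therefore `γ` is. -/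

namespace TopGpd

open Filter

/-! ### Algebra of groupoid elements with a total product. -/

section TotalAlgebra

variable {Y : Type*} [Groupoid Y]

open Classical in
/-- The product of elements of a groupoid, extended by the first factor to all pairs. -/
noncomputable instance : Mul (Quiver.Total Y) :=
  ⟨fun a b => if h : a.right = b.left then mul a b h else a⟩

instance : Inv (Quiver.Total Y) := ⟨inv⟩

theorem mul_def {a b : Quiver.Total Y} (h : a.right = b.left) : a * b = mul a b h := dif_pos h

theorem mk_mul_mk {x y z : Y} (a : x ⟶ y) (b : y ⟶ z) :
    (⟨x, y, a⟩ * ⟨y, z, b⟩ : Quiver.Total Y) = ⟨x, z, a ≫ b⟩ := by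
  rw [mul_def rfl]
  simp [mul]

theorem inv_mk {x y : Y} (a : x ⟶ y) :
    (⟨x, y, a⟩ : Quiver.Total Y)⁻¹ = ⟨y, x, Groupoid.inv a⟩ := rfl

@[simp] theorem left_one (x : Y) : (one x).left = x := (rfl)

@[simp] theorem right_one (x : Y) : (one x).right = x := (rfl)

@[simp] theorem left_inv (a : Quiver.Total Y) : a⁻¹.left = a.right := (rfl)

@[simp] theorem right_inv (a : Quiver.Total Y) : a⁻¹.right = a.left := (rfl)

-- No composability is needed, because the default product is the first factor.
@[simp] theorem left_mul (a b : Quiver.Total Y) : (a * b).left = a.left := by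
  by_cases h : a.right = b.left
  · rw [mul_def h]; rfl
  · exact congrArg Quiver.Total.left (dif_neg h : a * b = a)

@[simp] theorem right_mul {a b : Quiver.Total Y} (h : a.right = b.left) :
    (a * b).right = b.right := by
  rw [mul_def h]; rfl

theorem assoc {a b c : Quiver.Total Y} (h : a.right = b.left) (h' : b.right = c.left) :
    a * b * c = a * (b * c) := by
  obtain ⟨x, y, a⟩ := a
  obtain ⟨_, z, b⟩ := b
  obtain ⟨_, t, c⟩ := c
  obtain rfl : y = _ := h
  obtain rfl : z = _ := h'
  simp [mk_mul_mk]

@[simp] theorem inv_inv_total (a : Quiver.Total Y) : a⁻¹⁻¹ = a := by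
  obtain ⟨x, y, a⟩ := a
  simp [inv_mk]

theorem one_mul_of_left {x : Y} {a : Quiver.Total Y} (h : a.left = x) : one x * a = a := by
  obtain ⟨x, y, a⟩ := a
  obtain rfl : x = _ := h
  simp [one, mk_mul_mk]

theorem mul_one_of_right {y : Y} {a : Quiver.Total Y} (h : a.right = y) : a * one y = a := by
  obtain ⟨x, y, a⟩ := a
  obtain rfl : y = _ := h
  simp [one, mk_mul_mk]

@[simp] theorem inv_one_total (x : Y) : (one x)⁻¹ = one x := by
  simp [one, inv_mk]

theorem inv_mul_self_total (a : Quiver.Total Y) : a⁻¹ * a = one a.right := by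
  obtain ⟨x, y, a⟩ := a
  simp [one, inv_mk, mk_mul_mk]

theorem mul_inv_self_total (a : Quiver.Total Y) : a * a⁻¹ = one a.left := by
  obtain ⟨x, y, a⟩ := a
  simp [one, inv_mk, mk_mul_mk]

theorem inv_mul_cancel_of {a b : Quiver.Total Y} (h : a.right = b.left) : a⁻¹ * (a * b) = b := by
  rw [← assoc (by simp) h, inv_mul_self_total, one_mul_of_left h.symm]

theorem mul_inv_cancel_of {a b : Quiver.Total Y} (h : a.left = b.left) : a * (a⁻¹ * b) = b := by
  rw [← assoc (by simp) (by simpa), mul_inv_self_total, one_mul_of_left h.symm]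

theorem mul_mul_inv_cancel {a b : Quiver.Total Y} (h : a.right = b.left) : a * b * b⁻¹ = a := by
  rw [assoc h (by simp), mul_inv_self_total, mul_one_of_right h]

theorem mul_inv_mul_cancel {a b : Quiver.Total Y} (h : a.right = b.right) : a * b⁻¹ * b = a := by
  rw [assoc (by simpa) (by simp), inv_mul_self_total, mul_one_of_right h]

theorem mul_left_cancel_of {a b c : Quiver.Total Y} (h : a.right = b.left) (h' : a.right = c.left)
    (e : a * b = a * c) : b = c := by
  rw [← inv_mul_cancel_of h, e, inv_mul_cancel_of h']

theorem mul_right_cancel_of {a b c : Quiver.Total Y} (h : a.right = c.left) (h' : b.right = c.left)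
    (e : a * c = b * c) : a = b := by
  rw [← mul_mul_inv_cancel h, e, mul_mul_inv_cancel h']

theorem mul_inv_rev_of {a b : Quiver.Total Y} (h : a.right = b.left) :
    (a * b)⁻¹ = b⁻¹ * a⁻¹ := by
  obtain ⟨x, y, a⟩ := a
  obtain ⟨_, z, b⟩ := b
  obtain rfl : y = _ := h
  simp [inv_mk, mk_mul_mk]

variable {Z : Type*} [Groupoid Z] (F : Y ⥤ Z)

theorem mapTotal_mul {a b : Quiver.Total Y} (h : a.right = b.left) :
    mapTotal F (a * b) = mapTotal F a * mapTotal F b := by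
  obtain ⟨x, y, a⟩ := a
  obtain ⟨_, z, b⟩ := b
  obtain rfl : y = _ := h
  rw [mk_mul_mk]
  simp [mapTotal, mk_mul_mk]

theorem mapTotal_one (x : Y) : mapTotal F (one x) = one (F.obj x) := by
  simp [mapTotal, one]

theorem mapTotal_inv (a : Quiver.Total Y) : mapTotal F a⁻¹ = (mapTotal F a)⁻¹ := by
  obtain ⟨x, y, a⟩ := a
  simp [mapTotal, inv_mk]

end TotalAlgebra

/-! ### Generators and universal property of the monodromy groupoid. -/

section MonodromyAlgebra

variable {X : Type u} [Groupoid.{v} X] {W : Set (Quiver.Total X)}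

/-- The morphism of the monodromy groupoid represented by a morphism of the free groupoid. -/
def Monodromy.ofFree {x y : X} (f : (Quiver.FreeGroupoid.of (Graph W)).obj ⟨x⟩ ⟶
    (Quiver.FreeGroupoid.of (Graph W)).obj ⟨y⟩) : (⟨x⟩ : Monodromy W) ⟶ ⟨y⟩ :=
  (CategoryTheory.Quotient.functor (modN W)).map f

variable (W) in
open Classical in
/-- The element of the monodromy groupoid given by an element of `W` (an identity outside `W`). -/
noncomputable def br (a : Quiver.Total X) : Quiver.Total (Monodromy W) :=
  if h : a ∈ W then ⟨⟨a.left⟩, ⟨a.right⟩, Monodromy.ofFree (bracket W a.hom h)⟩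
  else one ⟨a.left⟩

theorem br_mk {x y : X} {a : x ⟶ y} (ha : (⟨x, y, a⟩ : Quiver.Total X) ∈ W) :
    br W ⟨x, y, a⟩ = ⟨⟨x⟩, ⟨y⟩, Monodromy.ofFree (bracket W a ha)⟩ := dif_pos ha

@[simp] theorem left_br (a : Quiver.Total X) : (br W a).left = ⟨a.left⟩ := by
  unfold br; split_ifs <;> rfl

@[simp] theorem right_br {a : Quiver.Total X} (h : a ∈ W) : (br W a).right = ⟨a.right⟩ := by
  rw [br, dif_pos h]

theorem br_mul {a b : Quiver.Total X} (ha : a ∈ W) (hb : b ∈ W) (h : a.right = b.left)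
    (hab : a * b ∈ W) : br W a * br W b = br W (a * b) := by
  obtain ⟨x, y, a⟩ := a
  obtain ⟨_, z, b⟩ := b
  obtain rfl : y = _ := h
  rw [mk_mul_mk] at hab
  rw [mk_mul_mk, br_mk ha, br_mk hb, br_mk hab, mk_mul_mk]
  congr 1
  have : modN W (bracket W a ha ≫ bracket W b hb) (bracket W (a ≫ b) hab) := by
    have := ((Subgroupoid.generatedNormal_isNormal (Relator W)).generatedNormal_le _).1
      le_rfl _ _ (Relator.mk a b ha hb hab)
    rw [← Category.assoc] at this
    exact this
  exact CategoryTheory.Quotient.sound _ this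

/-- An idempotent of a groupoid is an identity. -/
theorem br_one {x : X} (hx : one x ∈ W) : br W (one x) = one ⟨x⟩ := by
  have h := br_mul hx hx rfl (by rwa [one_mul_of_left (left_one x)])
  rw [one_mul_of_left (left_one x)] at h
  refine mul_left_cancel_of (a := br W (one x)) (by simp [hx]) (by simp [hx]) ?_
  rw [h, mul_one_of_right (by simp [hx])]

theorem br_inv (h1 : ∀ x : X, one x ∈ W) {a : Quiver.Total X} (ha : a ∈ W) (ha' : a⁻¹ ∈ W) :
    br W a⁻¹ = (br W a)⁻¹ := by
  refine mul_left_cancel_of (a := br W a) (by simp [ha]) (by simp) ?_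
  rw [br_mul ha ha' (by simp) (by rw [mul_inv_self_total]; exact h1 _), mul_inv_self_total,
    mul_inv_self_total, br_one (h1 _), left_br]

variable (W) in
/-- The canonical morphism on elements. -/
abbrev proj (u : Quiver.Total (Monodromy W)) : Quiver.Total X := mapTotal (canonical W) u

@[simp] theorem left_proj (u : Quiver.Total (Monodromy W)) : (proj W u).left = u.left.base := (rfl)

@[simp] theorem right_proj (u : Quiver.Total (Monodromy W)) : (proj W u).right = u.right.base := (rfl)

theorem proj_br {a : Quiver.Total X} (ha : a ∈ W) : proj W (br W a) = a := by
  obtain ⟨x, y, a⟩ := a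
  rw [br_mk ha]
  change (⟨x, y, (freeToBase W).map (bracket W a ha)⟩ : Quiver.Total X) = ⟨x, y, a⟩
  rw [freeToBase_bracket]

theorem proj_mul {u v : Quiver.Total (Monodromy W)} (h : u.right = v.left) :
    proj W (u * v) = proj W u * proj W v := mapTotal_mul _ h

theorem proj_inv (u : Quiver.Total (Monodromy W)) : proj W u⁻¹ = (proj W u)⁻¹ := mapTotal_inv _ u

theorem proj_one (x : Monodromy W) : proj W (one x) = one x.base := mapTotal_one _ x

/-- The monodromy groupoid is generated by the elements of `W`. -/
theorem Monodromy.induction {C : Quiver.Total (Monodromy W) → Prop}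
    (one : ∀ x, C (one x)) (mul : ∀ u v, u.right = v.left → C u → C v → C (u * v))
    (inv : ∀ u, C u → C u⁻¹) (br : ∀ a ∈ W, C (br W a)) (u : Quiver.Total (Monodromy W)) :
    C u := by
  obtain ⟨⟨x⟩, ⟨y⟩, f⟩ := u
  -- Two quotients are undone: the one by `N`, then the cancellation of words in the free groupoid.
  obtain ⟨f, rfl⟩ := Quot.exists_rep f
  obtain ⟨p, rfl⟩ := Quot.exists_rep f
  change Quiver.Path (V := Quiver.Symmetrify (Graph W)) ⟨x⟩ ⟨y⟩ at p
  -- The end point is freed for an induction on words in the generators and their formal inverses.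
  suffices H : ∀ (z : Quiver.Symmetrify (Graph W))
      (p : Quiver.Path (V := Quiver.Symmetrify (Graph W)) ⟨x⟩ z),
      C ⟨⟨x⟩, ⟨z.base⟩, Quot.mk _ (Quot.mk _ p)⟩ from H ⟨y⟩ p
  intro z p
  induction p with
  | nil => exact one ⟨x⟩
  | @cons b c p e ih =>
    obtain ⟨b⟩ := b
    obtain ⟨c⟩ := c
    rcases e with ⟨a, ha⟩ | ⟨a, ha⟩
    · have := mul _ _ (by simp) ih (br ⟨b, c, a⟩ ha)
      rw [br_mk ha] at this
      exact (congrArg C (mk_mul_mk (Y := Monodromy W) (x := ⟨x⟩) (y := ⟨b⟩) (z := ⟨c⟩)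
        (Quot.mk _ (Quot.mk _ p)) (ofFree (bracket W a ha)))).mp this
    · have := mul _ _ (by simp [ha]) ih (inv _ (br ⟨c, b, a⟩ ha))
      rw [br_mk ha, inv_mk] at this
      exact (congrArg C (mk_mul_mk (Y := Monodromy W) (x := ⟨x⟩) (y := ⟨b⟩) (z := ⟨c⟩)
        (Quot.mk _ (Quot.mk _ p)) (Groupoid.inv (ofFree (bracket W a ha))))).mp this

/-- The functor on the monodromy groupoid extending a local morphism on `W`. -/
theorem Monodromy.exists_lift {H : Type*} [Groupoid H] (o : X → H)
    (φ : ∀ {x y : X} (a : x ⟶ y), (⟨x, y, a⟩ : Quiver.Total X) ∈ W → (o x ⟶ o y))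
    (hφ : ∀ {x y z : X} (a : x ⟶ y) (b : y ⟶ z) (ha : (⟨x, y, a⟩ : Quiver.Total X) ∈ W)
      (hb : (⟨y, z, b⟩ : Quiver.Total X) ∈ W) (hab : (⟨x, z, a ≫ b⟩ : Quiver.Total X) ∈ W),
      φ a ha ≫ φ b hb = φ (a ≫ b) hab) :
    ∃ Φ : ∀ {x y : Monodromy W}, (x ⟶ y) → (o x.base ⟶ o y.base),
      (∀ x, Φ (𝟙 x) = 𝟙 _) ∧
      (∀ {x y z : Monodromy W} (f : x ⟶ y) (g : y ⟶ z), Φ (f ≫ g) = Φ f ≫ Φ g) ∧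
      ∀ {x y : X} (a : x ⟶ y) (ha : (⟨x, y, a⟩ : Quiver.Total X) ∈ W),
        Φ (Monodromy.ofFree (bracket W a ha)) = φ a ha := by
  let ψ : Graph W ⥤q H := { obj x := o x.base, map a := φ a.1 a.2 }
  let F : Free W ⥤ H := Quiver.FreeGroupoid.lift ψ
  have hF : ∀ {x y : X} (a : x ⟶ y) (ha : (⟨x, y, a⟩ : Quiver.Total X) ∈ W),
      F.map (bracket W a ha) = φ a ha := fun {x y} a ha => by
    change (𝟙 (o x) ≫ φ a ha : o x ⟶ o y) = φ a ha
    exact Category.id_comp _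
  -- The kernel is normal, so it contains `N` once it contains the relators.
  have hN : normalSubgroupoid W ≤ Subgroupoid.ker F := by
    refine ((Subgroupoid.ker_isNormal F).generatedNormal_le (Relator W)).2 ?_
    rintro _ _ _ ⟨a, b, ha, hb, hab⟩
    rw [Subgroupoid.mem_ker_iff]
    refine ⟨rfl, ?_⟩
    have key : F.map (bracket W a ha ≫ bracket W b hb) = F.map (bracket W (a ≫ b) hab) := by
      rw [Functor.map_comp, hF, hF, hF]
      exact hφ a b ha hb hab
    rw [← Category.assoc, Functor.map_comp, key, ← Functor.map_comp, Groupoid.comp_inv,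
      CategoryTheory.Functor.map_id]
    rfl
  have hmod : ∀ (c d : Free W) (f g : c ⟶ d), modN W f g → F.map f = F.map g := by
    intro c d f g h
    have h' : f ≫ Groupoid.inv g ∈ (Subgroupoid.ker F).arrows c c :=
      (Subgroupoid.le_iff _ _).1 hN h
    rw [Subgroupoid.mem_ker_iff] at h'
    obtain ⟨_, h'⟩ := h'
    rw [eqToHom_refl, Functor.map_comp, Groupoid.inv_eq_inv, Functor.map_inv,
      IsIso.comp_inv_eq, Category.id_comp] at h'
    exact h'
  let K := CategoryTheory.Quotient.lift (modN W) F hmod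
  refine ⟨fun {x y} f => K.map (X := x.toQuotient W) (Y := y.toQuotient W) f,
    fun x => K.map_id (x.toQuotient W), fun {x y z} f g => K.map_comp (X := x.toQuotient W)
      (Y := y.toQuotient W) (Z := z.toQuotient W) f g, fun a ha => hF a ha⟩

end MonodromyAlgebra

/-! ### Small elements and the exchange of small loops. -/

section TopologicalGroupoid

variable {X : Type u} [Groupoid.{v} X] [TopologicalSpace (Quiver.Total X)]
  {Z : Type*} {l : Filter Z} {f g : Z → Quiver.Total X} {a b : Quiver.Total X}

/-- The neighbourhoods of the identity `1_x` in the object group at `x`. -/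
def loopNhds (x : X) : Filter (Quiver.Total X) := 𝓝[{e | e.left = x ∧ e.right = x}] (one x)

theorem tendsto_loopNhds_iff {x : X} : Tendsto f l (loopNhds x) ↔
    Tendsto f l (𝓝 (one x)) ∧ ∀ᶠ z in l, (f z).left = x ∧ (f z).right = x :=
  tendsto_nhdsWithin_iff

theorem eventually_loopNhds (x : X) :
    ∀ᶠ e in loopNhds x, e.left = x ∧ e.right = x := eventually_mem_nhdsWithin

theorem eventually_mem_loopNhds {W : Set (Quiver.Total X)} (hW : IsOpen W) (h1 : ∀ x : X, one x ∈ W) (x : X) :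
    ∀ᶠ e in loopNhds x, e ∈ W :=
  mem_nhdsWithin_of_mem_nhds (hW.mem_nhds (h1 x))

variable [TopologicalSpace X] [IsTopologicalGroupoid X]

/-- Continuity of the partial product in filter form: the factors need only be composable
eventually. -/
theorem tendsto_mul (hf : Tendsto f l (𝓝 a)) (hg : Tendsto g l (𝓝 b)) (h : a.right = b.left)
    (hfg : ∀ᶠ z in l, (f z).right = (g z).left) :
    Tendsto (fun z => f z * g z) l (𝓝 (a * b)) := by
  have hc : ContinuousOn (fun p : Quiver.Total X × Quiver.Total X => p.1 * p.2)
      {p | p.1.right = p.2.left} := by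
    rw [continuousOn_iff_continuous_domRestrict]
    refine (IsTopologicalGroupoid.continuous_mul (X := X)).congr fun p => ?_
    exact (mul_def p.2).symm
  exact (hc (a, b) h).tendsto.comp (tendsto_nhdsWithin_iff.2 ⟨hf.prodMk_nhds hg, hfg⟩)

theorem tendsto_inv (hf : Tendsto f l (𝓝 a)) : Tendsto (fun z => (f z)⁻¹) l (𝓝 a⁻¹) :=
  ((IsTopologicalGroupoid.continuous_inv (X := X)).tendsto a).comp hf

theorem tendsto_left (hf : Tendsto f l (𝓝 a)) : Tendsto (fun z => (f z).left) l (𝓝 a.left) :=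
  ((IsTopologicalGroupoid.continuous_source (X := X)).tendsto a).comp hf

theorem tendsto_conj {x : X} (h : a.left = x) :
    Tendsto (fun e => a⁻¹ * (e * a)) (loopNhds x) (loopNhds a.right) := by
  have h0 : Tendsto (fun e => e) (loopNhds x) (𝓝 (one x)) := tendsto_nhdsWithin_of_tendsto_nhds
    tendsto_id
  have hl := eventually_loopNhds x
  refine tendsto_loopNhds_iff.2 ⟨?_, ?_⟩
  · have := tendsto_mul (f := fun _ => a⁻¹) tendsto_const_nhds
      (tendsto_mul h0 (tendsto_const_nhds (x := a)) h.symm ?_) (by simp [h]) ?_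
    · rwa [one_mul_of_left h, inv_mul_self_total] at this
    · filter_upwards [hl] with e he using by rw [he.2, h]
    · filter_upwards [hl] with e he using by simp [he, h]
  · filter_upwards [hl] with e he
    simp [he, h]

variable {W : Set (Quiver.Total X)}

/-- Openness of `W` lets a relation of `M(G,W)` persist at nearby composable pairs. -/
theorem eventually_br_mul (hW : IsOpen W) (hf : Tendsto f l (𝓝 a)) (hg : Tendsto g l (𝓝 b))
    (h : a.right = b.left) (hfg : ∀ᶠ z in l, (f z).right = (g z).left) (ha : a ∈ W) (hb : b ∈ W)
    (hab : a * b ∈ W) : ∀ᶠ z in l, f z ∈ W ∧ g z ∈ W ∧ br W (f z * g z) = br W (f z) * br W (g z) := by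
  filter_upwards [hf (hW.mem_nhds ha), hg (hW.mem_nhds hb), hfg,
    tendsto_mul hf hg h hfg (hW.mem_nhds hab)] with z h1 h2 h3 h4
  exact ⟨h1, h2, (br_mul h1 h2 h3 h4).symm⟩

/-- Small elements of the object groups commute with the elements of the monodromy groupoid, up
to the conjugation of the groupoid. -/
theorem eventually_br_mul_comm (hW : IsOpen W) (h1 : ∀ x : X, one x ∈ W)
    (u : Quiver.Total (Monodromy W)) : ∀ᶠ e in loopNhds u.left.base,
      br W e * u = u * br W ((proj W u)⁻¹ * (e * proj W u)) := by
  -- The neighbourhood of admissible `e` may shrink with each letter of `u`; no uniformity in `u` is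
  -- needed.
  induction u using Monodromy.induction with
  | one x =>
    filter_upwards [eventually_loopNhds _, eventually_mem_loopNhds hW h1 _] with e he heW
    rw [proj_one]
    simp only [left_one] at he
    rw [mul_one_of_right (by simp [heW, he]), mul_one_of_right he.2, inv_one_total,
      one_mul_of_left he.1, one_mul_of_left (by simp [he])]
  | mul u v h hu hv =>
    have hbase : u.right.base = v.left.base := by rw [h]
    rw [left_mul]
    have hc := tendsto_conj (a := proj W u) (x := u.left.base) rfl
    rw [right_proj, hbase] at hc
    filter_upwards [hu, hc.eventually hv, eventually_loopNhds _, eventually_mem_loopNhds hW h1 _,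
      hc.eventually (eventually_mem_loopNhds hW h1 _),
      (tendsto_conj (a := proj W v) rfl |>.comp hc).eventually (eventually_mem_loopNhds hW h1 _)]
      with e hu hv he heW heW' heW''
    simp only [Function.comp_def] at heW''
    have e1 : (proj W v)⁻¹ * (((proj W u)⁻¹ * (e * proj W u)) * proj W v) =
        (proj W (u * v))⁻¹ * (e * proj W (u * v)) := by
      rw [proj_mul h, mul_inv_rev_of (by simp [hbase])]
      rw [assoc (by simp [he]) (by simp [he, hbase]), assoc (by simp [he]) hbase,
        assoc (by simp [hbase]) (by simp [he])]
    rw [← assoc (by simp [heW, he]) h, hu,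
      assoc (by simp) (by simp [heW', he, hbase]), hv,
      ← assoc h (by simp), e1]
  | inv u hu =>
    have hc := tendsto_conj (a := (proj W u)⁻¹) (x := u.right.base) rfl
    rw [right_inv, left_proj, inv_inv_total] at hc
    rw [left_inv]
    filter_upwards [hc.eventually hu, eventually_loopNhds _, eventually_mem_loopNhds hW h1 _,
      hc.eventually (eventually_mem_loopNhds hW h1 _)] with e hu he heW heW'
    have e1 : (proj W u)⁻¹ * (proj W u * (e * (proj W u)⁻¹) * proj W u) = e := by
      rw [assoc (by simp [he]) (by simp [he]), mul_inv_mul_cancel (by simp [he]),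
        inv_mul_cancel_of (by simp [he])]
    rw [e1] at hu
    rw [proj_inv, inv_inv_total]
    refine mul_left_cancel_of (a := u) (by simp [he]) (by simp) ?_
    rw [← assoc (by simp [he]) (by simp [he, heW]), ← hu,
      mul_mul_inv_cancel (by rw [right_br heW', right_mul (by simp [he]), right_mul (by simp [he])]; rfl),
      mul_inv_cancel_of (by simp)]
  -- For small `e`, both sides are `[e w]`, as `e w = w (w⁻¹ e w)` and all factors stay in `W`.
  | br w hw =>
    rw [left_br]
    have h0 : Tendsto (fun e => e) (loopNhds w.left) (𝓝 (one w.left)) :=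
      tendsto_nhdsWithin_of_tendsto_nhds tendsto_id
    have hc := tendsto_conj (a := w) (x := w.left) rfl
    have hl := eventually_loopNhds w.left
    filter_upwards [hl, eventually_br_mul hW h0 (tendsto_const_nhds (x := w)) rfl
        (hl.mono fun e he => he.2) (h1 _) hw (by rwa [one_mul_of_left rfl]),
      eventually_br_mul hW (tendsto_const_nhds (x := w)) (tendsto_loopNhds_iff.1 hc).1 rfl
        (hl.mono fun e he => by simp) hw (h1 _)
        (by rwa [mul_one_of_right rfl])] with e he e1 e2
    rw [proj_br hw, ← e1.2.2, ← e2.2.2, mul_inv_cancel_of (by simp [he])]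

variable {e e' f' : Z → Quiver.Total X}

/-- Multiplication of `u` on both sides by small elements is determined by its image. -/
theorem eventually_eq_of_small (hW : IsOpen W) (h1 : ∀ x : X, one x ∈ W)
    (u : Quiver.Total (Monodromy W))
    (he : Tendsto e l (𝓝 (one u.left.base))) (he_r : ∀ᶠ z in l, (e z).right = u.left.base)
    (he' : Tendsto e' l (𝓝 (one u.left.base))) (he'_r : ∀ᶠ z in l, (e' z).right = u.left.base)
    (hf : Tendsto f l (𝓝 (one u.right.base))) (hf_l : ∀ᶠ z in l, (f z).left = u.right.base)
    (hf'_l : ∀ᶠ z in l, (f' z).left = u.right.base)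
    (h : ∀ᶠ z in l, e z * (proj W u * f z) = e' z * (proj W u * f' z)) :
    ∀ᶠ z in l, br W (e z) * (u * br W (f z)) = br W (e' z) * (u * br W (f' z)) := by
  have hll : ∀ᶠ z in l, (e z).left = (e' z).left := h.mono fun z hz => by
    simpa using congrArg Quiver.Total.left hz
  -- The discrepancy of the two left factors is a small loop, which can be moved across `u`.
  have hk : Tendsto (fun z => (e' z)⁻¹ * e z) l (loopNhds u.left.base) := by
    refine tendsto_loopNhds_iff.2 ⟨?_, ?_⟩
    · have := tendsto_mul (tendsto_inv he') he (by simp) (hll.mono fun z hz => by simp [hz])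
      rwa [inv_mul_self_total] at this
    · filter_upwards [hll, he_r, he'_r] with z h1 h2 h3
      rw [right_mul (by simp [h1]), left_mul]
      exact ⟨h3, h2⟩
  have hc := (tendsto_conj (a := proj W u) (x := u.left.base) rfl).comp hk
  have hc_l := (tendsto_loopNhds_iff.1 hc).2
  have hk_l := (tendsto_loopNhds_iff.1 hk).2
  filter_upwards [h, hll, he_r, he'_r, hf_l, hf'_l, hk_l, hc_l,
    hk.eventually (eventually_br_mul_comm hW h1 u),
    eventually_br_mul hW he' (tendsto_loopNhds_iff.1 hk).1 (by simp)
      (hk_l.mono fun z hz => by simp) (h1 _) (h1 _) (by rw [one_mul_of_left (left_one _)]; exact h1 _),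
    eventually_br_mul hW (tendsto_loopNhds_iff.1 hc).1 hf (by simp)
      (by filter_upwards [hc_l, hf_l] with z h1 h2; simpa [h2] using h1.2) (h1 _) (h1 _)
      (by rw [one_mul_of_left (by simp)]; exact h1 _)]
    with z h hll her he'r hfl hf'l hkl hcl hcomm hb1 hb2
  simp only [Function.comp_apply] at hb2 hcl
  set k := (e' z)⁻¹ * e z with hkdef
  set c := (proj W u)⁻¹ * (k * proj W u) with hcdef
  have hek : e z = e' z * k := (mul_inv_cancel_of hll.symm).symm
  -- Equality of the images determines `f'`, so its convergence need not be assumed.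
  have hf'c : f' z = c * f z := by
    have : proj W u * f' z = k * (proj W u * f z) := by
      refine mul_left_cancel_of (a := e' z) (by simp [he'r]) (by simp [hkl, he'r]) ?_
      rw [← h, ← assoc (a := e' z) (b := k) (by simp [hkl, he'r]) (by simp [hkl]), ← hek]
    rw [hcdef, assoc (by simp [hkl]) (by rw [right_mul (by simp [hkl]), hfl]; rfl), assoc (by simp [hkl]) (by simp [hfl]),
      ← this, inv_mul_cancel_of (by simp [hf'l])]
  have hkW := hb1.2.1
  have hcW := hb2.1
  rw [hek, hb1.2.2, hf'c, hb2.2.2, assoc (by simp [hb1.1, k]) (by simp [hkW, hkl]),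
    ← assoc (b := u) (by simp [hkW, hkl]) (by simp [hfl]), hcomm, assoc (by simp [hcl])
    (by simp [hcW, hcl, hfl])]

end TopologicalGroupoid

/-! ### Local lifts and the topology they define. -/

section LocalSections

variable {X : Type u} [Groupoid.{v} X] [TopologicalSpace X] [TopologicalSpace (Quiver.Total X)]

/-- A family of sections of the final point map into the stars, each defined and continuous near
the base point of its star. -/
structure IsLocalSection (S : X → X → Quiver.Total X) : Prop where
  self : ∀ x, S x x = one x
  spec : ∀ x, ∀ᶠ y in 𝓝 x, ContinuousAt (S x) y ∧ (S x y).left = x ∧ (S x y).right = y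

theorem CompatibleLocalSections.exists_isLocalSection {ι : Type w}
    (T : CompatibleLocalSections X ι) : ∃ S : X → X → Quiver.Total X, IsLocalSection S := by
  have hx : ∀ x : X, ∃ i, x ∈ T.U i := fun x => by
    obtain ⟨_, ⟨i, rfl⟩, hi, -⟩ := T.isBasis.exists_subset_of_mem_open (Set.mem_univ x) isOpen_univ
    exact ⟨i, hi⟩
  choose i hi using hx
  refine ⟨fun x => T.s (i x) x, fun x => T.s_self _ x (hi x), fun x => ?_⟩
  have ho : IsOpen (T.U (i x)) := T.isBasis.isOpen ⟨_, rfl⟩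
  filter_upwards [ho.mem_nhds (hi x)] with y hy
  exact ⟨(T.continuousOn_s _ x (hi x)).continuousAt (ho.mem_nhds hy),
    T.source_s _ x (hi x) y hy, T.target_s _ x (hi x) y hy⟩

variable (S : X → X → Quiver.Total X) {W : Set (Quiver.Total X)}

/-- The left factor of `g`, close to `1_x`. -/
def leftPart (x : X) (g : Quiver.Total X) : Quiver.Total X := (S x g.left)⁻¹

/-- The right factor of an element `g` close to `a`. -/
noncomputable def rightPart (a g : Quiver.Total X) : Quiver.Total X := a⁻¹ * (S a.left g.left * g)

variable (W) in
/-- The local section at `u` of the projection of the monodromy groupoid. -/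
noncomputable def localLift (u : Quiver.Total (Monodromy W)) (g : Quiver.Total X) :
    Quiver.Total (Monodromy W) :=
  br W (leftPart S u.left.base g) * (u * br W (rightPart S (proj W u) g))

variable {S}

theorem leftPart_self (hS : IsLocalSection S) (a : Quiver.Total X) :
    leftPart S a.left a = one a.left := by
  rw [leftPart, hS.self, inv_one_total]

theorem rightPart_self (hS : IsLocalSection S) (a : Quiver.Total X) :
    rightPart S a a = one a.right := by
  rw [rightPart, hS.self, one_mul_of_left rfl, inv_mul_self_total]

theorem localLift_self (hS : IsLocalSection S) (h1 : ∀ x : X, one x ∈ W)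
    (u : Quiver.Total (Monodromy W)) : localLift S W u (proj W u) = u := by
  have hl := leftPart_self hS (proj W u)
  rw [left_proj] at hl
  rw [localLift, hl, rightPart_self hS, br_one (h1 _), br_one (h1 _),
    one_mul_of_left (by simp), mul_one_of_right (by simp)]

variable [IsTopologicalGroupoid X]

theorem eventually_parts (hS : IsLocalSection S) (a : Quiver.Total X) :
    ∀ᶠ g in 𝓝 a, ContinuousAt (leftPart S a.left) g ∧ ContinuousAt (rightPart S a) g ∧
      (leftPart S a.left g).left = g.left ∧ (leftPart S a.left g).right = a.left ∧
      (rightPart S a g).left = a.right ∧ (rightPart S a g).right = g.right ∧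
      leftPart S a.left g * (a * rightPart S a g) = g := by
  -- Continuity of a partial product at `g` requires end points to match on a neighbourhood of `g`,
  -- hence `eventually_nhds`.
  have h := (tendsto_left (f := fun g => g) tendsto_id).eventually
    ((hS.spec a.left).eventually_nhds)
  filter_upwards [h] with g hg
  have hev := (tendsto_left (f := fun g => g) tendsto_id).eventually hg
  obtain ⟨hc, hl, hr⟩ := hg.self_of_nhds
  have hc' : ContinuousAt (fun g : Quiver.Total X => S a.left g.left) g :=
    hc.tendsto.comp (tendsto_left (f := fun g => g) tendsto_id)
  refine ⟨tendsto_inv hc', ?_, hr, hl, left_mul _ _, ?_, ?_⟩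
  · refine tendsto_mul tendsto_const_nhds (tendsto_mul hc' tendsto_id hr ?_) (by simp [hl]) ?_
    · exact hev.mono fun g' hg' => hg'.2.2
    · exact hev.mono fun g' hg' => by simp [hg'.2.1]
  · rw [rightPart, right_mul (by simp [hl]), right_mul hr]
  · rw [rightPart, leftPart, mul_inv_cancel_of (by simp [hl]), inv_mul_cancel_of hr]

theorem eventually_parts_mem (hS : IsLocalSection S) (hW : IsOpen W) (h1 : ∀ x : X, one x ∈ W)
    (a : Quiver.Total X) :
    ∀ᶠ g in 𝓝 a, leftPart S a.left g ∈ W ∧ rightPart S a g ∈ W := by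
  obtain ⟨hl, hr, -⟩ := (eventually_parts hS a).self_of_nhds
  refine (hl.eventually (hW.mem_nhds ?_)).and (hr.eventually (hW.mem_nhds ?_))
  · rw [leftPart_self hS]; exact h1 _
  · rw [rightPart_self hS]; exact h1 _

theorem eventually_proj_localLift (hS : IsLocalSection S) (hW : IsOpen W)
    (h1 : ∀ x : X, one x ∈ W) (u : Quiver.Total (Monodromy W)) :
    ∀ᶠ g in 𝓝 (proj W u), proj W (localLift S W u g) = g := by
  filter_upwards [eventually_parts hS (proj W u), eventually_parts_mem hS hW h1 (proj W u)]
    with g ⟨_, _, h3, h4, h5, h6, h7⟩ ⟨h8, h9⟩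
  simp only [left_proj] at h4 h7 h8
  simp only [right_proj] at h5
  rw [localLift, proj_mul (by simp [h8, h4]), proj_mul (by simp [h5]), proj_br h8, proj_br h9, h7]

variable {Z : Type*} {l : Filter Z} {e f : Z → Quiver.Total X} {e₁ f₁ : Quiver.Total X}

/-- Here `e₁`, `f₁` are any elements of `W`, not only identities. Writing `e = (e e₁⁻¹) e₁` and `f =
f₁ (f₁⁻¹ f)` reduces to small factors around `[e₁] u [f₁]`, where `eventually_eq_of_small` applies.
-/
theorem eventually_eq_localLift (hS : IsLocalSection S) (hW : IsOpen W) (h1 : ∀ x : X, one x ∈ W)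
    (u : Quiver.Total (Monodromy W)) (he : Tendsto e l (𝓝 e₁)) (hf : Tendsto f l (𝓝 f₁))
    (he₁ : e₁ ∈ W) (hf₁ : f₁ ∈ W) (he₁_r : e₁.right = u.left.base) (hf₁_l : f₁.left = u.right.base)
    (he_r : ∀ᶠ z in l, (e z).right = u.left.base) (hf_l : ∀ᶠ z in l, (f z).left = u.right.base) :
    ∀ᶠ z in l, br W (e z) * (u * br W (f z)) =
      localLift S W (br W e₁ * (u * br W f₁)) (e z * (proj W u * f z)) := by
  set u₁ := br W e₁ * (u * br W f₁) with hu₁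
  have hul : u₁.left.base = e₁.left := by simp [u₁]
  have hur : u₁.right.base = f₁.right := by simp [u₁, he₁, he₁_r, hf₁, hf₁_l]
  have hpu : proj W u₁ = e₁ * (proj W u * f₁) := by
    rw [hu₁, proj_mul (by simp [he₁, he₁_r]), proj_mul (by simp [hf₁_l]), proj_br he₁, proj_br hf₁]
  have hê : Tendsto (fun z => e z * e₁⁻¹) l (𝓝 (one e₁.left)) := by
    have := tendsto_mul he (tendsto_const_nhds (x := e₁⁻¹)) (by simp)
      (he_r.mono fun z hz => by simp [hz, he₁_r])
    rwa [mul_inv_self_total] at this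
  have hf' : Tendsto (fun z => f₁⁻¹ * f z) l (𝓝 (one f₁.right)) := by
    have := tendsto_mul (tendsto_const_nhds (x := f₁⁻¹)) hf (by simp)
      (hf_l.mono fun z hz => by simp [hz, hf₁_l])
    rwa [inv_mul_self_total] at this
  have hg : Tendsto (fun z => e z * (proj W u * f z)) l (𝓝 (proj W u₁)) := by
    rw [hpu]
    refine tendsto_mul he (tendsto_mul tendsto_const_nhds hf (by simp [hf₁_l]) ?_)
      (by simp [he₁_r]) ?_
    · exact hf_l.mono fun z hz => by simp [hz]
    · exact he_r.mono fun z hz => by simp [hz]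
  obtain ⟨hlc, hrc, -⟩ := (eventually_parts hS (proj W u₁)).self_of_nhds
  have hlc' := hlc.tendsto.comp hg
  rw [leftPart_self hS] at hlc'
  have hp := hg.eventually (eventually_parts hS (proj W u₁))
  have key := eventually_eq_of_small hW h1 u₁ (by rwa [hul])
    (by filter_upwards [he_r] with z hz; simp [hul, hz, he₁_r]) hlc'
    (hp.mono fun z hz => hz.2.2.2.1) (by rwa [hur])
    (by filter_upwards with z; simp [hur]) (hp.mono fun z hz => hz.2.2.2.2.1) ?_
  · filter_upwards [key, he_r, hf_l,
      eventually_br_mul hW hê (tendsto_const_nhds (x := e₁)) rfl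
        (he_r.mono fun z hz => by simp [hz, he₁_r]) (h1 _) he₁ (by rwa [one_mul_of_left rfl]),
      eventually_br_mul hW (tendsto_const_nhds (x := f₁)) hf' rfl
        (hf_l.mono fun z hz => by simp) hf₁ (h1 _) (by rwa [mul_one_of_right rfl])]
      with z hz her hfl hb1 hb2
    rw [mul_inv_mul_cancel (by rw [her, he₁_r])] at hb1
    rw [mul_inv_cancel_of (by rw [hfl, hf₁_l])] at hb2
    refine Eq.trans ?_ hz
    rw [hb1.2.2, hb2.2.2, hu₁]
    have c1 : (br W (e z * e₁⁻¹)).right = (br W e₁).left := by simp [hb1.1, her, he₁_r]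
    have c2 : (br W e₁).right = u.left := by simp [he₁, he₁_r]
    have c3 : u.right = (br W f₁).left := by simp [hf₁_l]
    have c4 : (br W f₁).right = (br W (f₁⁻¹ * f z)).left := by simp [hf₁]
    rw [assoc c1 (by rw [c2, left_mul]), ← assoc c3 c4,
      assoc (a := br W e₁) (by rw [c2, left_mul]) (by rw [right_mul c3, c4])]
  · filter_upwards [hp, he_r, hf_l] with z hz her hfl
    refine Eq.trans ?_ hz.2.2.2.2.2.2.symm
    rw [hpu]
    rw [assoc (c := f₁⁻¹ * f z) (by simp [he₁_r]) (by simp [hf₁_l]),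
      assoc (c := f₁⁻¹ * f z) (by simp [hf₁_l]) (by simp),
      mul_inv_cancel_of (by rw [hfl, hf₁_l]), assoc (by simp [her, he₁_r]) (by simp),
      inv_mul_cancel_of (by simp [he₁_r])]

/-- This coherence is what the neighbourhood axiom in `nhds_monodromy` needs. It is
`eventually_eq_localLift` applied to the two parts of `g` at `p u`. -/
theorem eventually_localLift_localLift (hS : IsLocalSection S) (hW : IsOpen W)
    (h1 : ∀ x : X, one x ∈ W) (u : Quiver.Total (Monodromy W)) :
    ∀ᶠ g in 𝓝 (proj W u), localLift S W (localLift S W u g) =ᶠ[𝓝 g] localLift S W u := by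
  filter_upwards [(eventually_parts hS (proj W u)).eventually_nhds,
    eventually_parts_mem hS hW h1 (proj W u)] with g hg ⟨h8, h9⟩
  obtain ⟨h1', h2', h3, h4, h5, h6, h7⟩ := hg.self_of_nhds
  filter_upwards [hg, eventually_eq_localLift hS hW h1 u h1' h2' h8 h9 h4 h5
    (hg.mono fun z hz => hz.2.2.2.1) (hg.mono fun z hz => hz.2.2.2.2.1)] with z hz hz'
  have := hz.2.2.2.2.2.2
  rw [this] at hz'
  exact hz'.symm

variable (W S) in
/-- The topology of the monodromy groupoid: the local lifts are homeomorphisms onto their open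
images. -/
@[reducible] noncomputable def monodromyTopology : TopologicalSpace (Quiver.Total (Monodromy W)) :=
  TopologicalSpace.mkOfNhds fun u => Filter.map (localLift S W u) (𝓝 (proj W u))

theorem nhds_monodromy (hS : IsLocalSection S) (hW : IsOpen W) (h1 : ∀ x : X, one x ∈ W)
    (u : Quiver.Total (Monodromy W)) :
    @nhds _ (monodromyTopology S W) u = Filter.map (localLift S W u) (𝓝 (proj W u)) := by
  refine TopologicalSpace.nhds_mkOfNhds _ u (fun u => ?_) fun u s hs => ?_
  · have := Filter.map_mono (m := localLift S W u) (pure_le_nhds (proj W u))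
    rwa [map_pure, localLift_self hS h1] at this
  · rw [mem_map] at hs
    refine eventually_map.2 ?_
    filter_upwards [eventually_localLift_localLift hS hW h1 u, eventually_eventually_nhds.2 hs,
      eventually_proj_localLift hS hW h1 u] with g h1 h2 h3
    rw [h3, mem_map]
    filter_upwards [h1, h2] with g' h4 h5
    rw [Set.mem_preimage, h4]
    exact h5

end LocalSections

/-! ### The monodromy groupoid is a topological groupoid. -/

section MonodromyTopology

variable {X : Type u} [Groupoid.{v} X] [TopologicalSpace X] [TopologicalSpace (Quiver.Total X)]
  [IsTopologicalGroupoid X] {S : X → X → Quiver.Total X} {W : Set (Quiver.Total X)}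
  [TopologicalSpace (Quiver.Total (Monodromy W))]

variable (S W) in
/-- The topology of the monodromy groupoid is the one given by the local lifts. -/
def IsLiftTopology : Prop :=
  ∀ u : Quiver.Total (Monodromy W), 𝓝 u = Filter.map (localLift S W u) (𝓝 (proj W u))

variable (hS : IsLocalSection S) (hW : IsOpen W) (h1 : ∀ x : X, one x ∈ W)
  (hτ : IsLiftTopology S W)

include hS hW h1 hτ

theorem continuous_proj : Continuous (proj W) := by
  refine continuous_iff_continuousAt.2 fun u => ?_
  rw [ContinuousAt, hτ u, tendsto_map'_iff]
  exact tendsto_id.congr' ((eventually_proj_localLift hS hW h1 u).mono fun g hg => hg.symm)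

theorem eventually_localLift_proj (u : Quiver.Total (Monodromy W)) :
    ∀ᶠ u' in 𝓝 u, localLift S W u (proj W u') = u' := by
  rw [hτ u, eventually_map]
  exact (eventually_proj_localLift hS hW h1 u).mono fun g hg => by rw [hg]

variable {Z : Type*} {l : Filter Z} {e f : Z → Quiver.Total X} {e₁ f₁ : Quiver.Total X}

/-- The source of the later continuity proofs: the product is eventually a local lift of a
convergent family in `G`. -/
theorem tendsto_br_mul (u : Quiver.Total (Monodromy W)) (he : Tendsto e l (𝓝 e₁))
    (hf : Tendsto f l (𝓝 f₁)) (he₁ : e₁ ∈ W) (hf₁ : f₁ ∈ W) (he₁_r : e₁.right = u.left.base)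
    (hf₁_l : f₁.left = u.right.base) (he_r : ∀ᶠ z in l, (e z).right = u.left.base)
    (hf_l : ∀ᶠ z in l, (f z).left = u.right.base) :
    Tendsto (fun z => br W (e z) * (u * br W (f z))) l (𝓝 (br W e₁ * (u * br W f₁))) := by
  refine Tendsto.congr' (EventuallyEq.symm
    (eventually_eq_localLift hS hW h1 u he hf he₁ hf₁ he₁_r hf₁_l he_r hf_l)) ?_
  rw [hτ]
  refine tendsto_map.comp ?_
  rw [proj_mul (by simp [he₁, he₁_r]), proj_mul (by simp [hf₁_l]), proj_br he₁, proj_br hf₁]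
  exact tendsto_mul he (tendsto_mul tendsto_const_nhds hf (by simp [hf₁_l])
    (hf_l.mono fun z hz => by simp [hz])) (by simp [he₁_r]) (he_r.mono fun z hz => by simp [hz])

theorem tendsto_br_mul_one (u : Quiver.Total (Monodromy W))
    (he : Tendsto e l (𝓝 (one u.left.base))) (hf : Tendsto f l (𝓝 (one u.right.base)))
    (he_r : ∀ᶠ z in l, (e z).right = u.left.base) (hf_l : ∀ᶠ z in l, (f z).left = u.right.base) :
    Tendsto (fun z => br W (e z) * (u * br W (f z))) l (𝓝 u) := by
  have := tendsto_br_mul hS hW h1 hτ u he hf (h1 _) (h1 _) rfl rfl he_r hf_l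
  rwa [br_one (h1 _), br_one (h1 _), mul_one_of_right rfl, one_mul_of_left rfl] at this

theorem tendsto_mul_br (u : Quiver.Total (Monodromy W)) (hf : Tendsto f l (𝓝 f₁)) (hf₁ : f₁ ∈ W)
    (hf₁_l : f₁.left = u.right.base) (hf_l : ∀ᶠ z in l, (f z).left = u.right.base) :
    Tendsto (fun z => u * br W (f z)) l (𝓝 (u * br W f₁)) := by
  have := tendsto_br_mul hS hW h1 hτ u (e := fun _ => one u.left.base) tendsto_const_nhds hf (h1 _)
    hf₁ rfl hf₁_l (by simp) hf_l
  simpa only [br_one (h1 _), one_mul_of_left (left_mul _ _)] using this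

/-- The elements near `u` are obtained from `u` by multiplication with small elements. -/
theorem exists_parts (u : Quiver.Total (Monodromy W)) : ∃ e f : Quiver.Total (Monodromy W) →
    Quiver.Total X, Tendsto e (𝓝 u) (𝓝 (one u.left.base)) ∧ Tendsto f (𝓝 u) (𝓝 (one u.right.base)) ∧
      ∀ᶠ u' in 𝓝 u, e u' ∈ W ∧ f u' ∈ W ∧ (e u').left = u'.left.base ∧
        (e u').right = u.left.base ∧ (f u').left = u.right.base ∧ (f u').right = u'.right.base ∧
        u' = br W (e u') * (u * br W (f u')) := by
  have hp := (continuous_proj hS hW h1 hτ).tendsto u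
  obtain ⟨hl, hr, -⟩ := (eventually_parts hS (proj W u)).self_of_nhds
  refine ⟨fun u' => leftPart S u.left.base (proj W u'), fun u' => rightPart S (proj W u) (proj W u'),
    ?_, ?_, ?_⟩
  · have := hl.tendsto.comp hp
    rwa [leftPart_self hS] at this
  · have := hr.tendsto.comp hp
    rwa [rightPart_self hS] at this
  · filter_upwards [hp.eventually (eventually_parts hS (proj W u)),
      hp.eventually (eventually_parts_mem hS hW h1 (proj W u)),
      eventually_localLift_proj hS hW h1 hτ u] with u' ⟨_, _, h3, h4, h5, h6, _⟩ ⟨h8, h9⟩ h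
    exact ⟨h8, h9, h3, h4, h5, h6, h.symm⟩

/-- Near `u`, the inverse of `[e] u [f]` is `[f⁻¹] u⁻¹ [e⁻¹]`. -/
theorem continuous_inv_monodromy :
    Continuous (fun u : Quiver.Total (Monodromy W) => u⁻¹) := by
  refine continuous_iff_continuousAt.2 fun u => ?_
  obtain ⟨e, f, he, hf, h⟩ := exists_parts hS hW h1 hτ u
  have he' := tendsto_inv he
  have hf' := tendsto_inv hf
  rw [inv_one_total] at he' hf'
  refine (tendsto_br_mul_one hS hW h1 hτ u⁻¹ hf' he' (h.mono fun u' hu' => hu'.2.2.2.2.1)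
    (h.mono fun u' hu' => hu'.2.2.2.1)).congr' ?_
  filter_upwards [h, he' (hW.mem_nhds (h1 _)), hf' (hW.mem_nhds (h1 _))]
    with u' ⟨h3, h4, h5, h6, h7, h8, h9⟩ h10 h11
  conv_rhs => rw [h9]
  have c1 : (br W (e u')).right = u.left := by simp [h3, h6]
  have c2 : u.right = (br W (f u')).left := by simp [h7]
  rw [mul_inv_rev_of (by rw [left_mul, c1]), mul_inv_rev_of c2, br_inv h1 h3 h10, br_inv h1 h4 h11,
    assoc (by simp [h7]) (by simp [c1])]

/-- For `y` near `x` one has `1_y = [s⁻¹] 1_x [s]`, where `s = S x y` is small. -/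
theorem continuous_one_monodromy : Continuous (one : Monodromy W → Quiver.Total (Monodromy W)) := by
  have hb : Continuous (Monodromy.base : Monodromy W → X) := continuous_induced_dom
  refine continuous_iff_continuousAt.2 fun x => ?_
  have hs := (hb.tendsto x).eventually (hS.spec x.base)
  have hc : Tendsto (fun y : Monodromy W => S x.base y.base) (𝓝 x) (𝓝 (one x.base)) := by
    have := (hS.spec x.base).self_of_nhds.1.tendsto.comp (hb.tendsto x)
    rwa [hS.self] at this
  have hc' := tendsto_inv hc
  rw [inv_one_total] at hc'
  refine (tendsto_br_mul_one hS hW h1 hτ (one x) hc' hc (hs.mono fun y hy => hy.2.1)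
    (hs.mono fun y hy => hy.2.1)).congr' ?_
  filter_upwards [hs, hc (hW.mem_nhds (h1 _)), hc' (hW.mem_nhds (h1 _))] with y ⟨_, hy, hy'⟩ h2 h3
  rw [Set.mem_preimage] at h2 h3
  rw [one_mul_of_left (by simp [hy]), br_inv h1 h2 h3, inv_mul_self_total, right_br h2, hy']

/-- In `[e] u [f] [e'] v [f']` the middle `k = f e'` is a small loop. Moving it across `v` turns it
into a conjugate `c` and gives `[e] (u v) [c f']`. -/
theorem tendsto_mul_monodromy {u v : Quiver.Total (Monodromy W)} (huv : u.right = v.left)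
    {p q : Z → Quiver.Total (Monodromy W)} (hp : Tendsto p l (𝓝 u)) (hq : Tendsto q l (𝓝 v))
    (hpq : ∀ᶠ z in l, (p z).right = (q z).left) :
    Tendsto (fun z => p z * q z) l (𝓝 (u * v)) := by
  obtain ⟨e, f, he, hf, h⟩ := exists_parts hS hW h1 hτ u
  obtain ⟨e', f', he', hf', h'⟩ := exists_parts hS hW h1 hτ v
  have hb : u.right.base = v.left.base := by rw [huv]
  rw [hb] at hf
  have hfe : ∀ᶠ z in l, (f (p z)).right = (e' (q z)).left := by
    filter_upwards [hp.eventually h, hq.eventually h', hpq] with z h2 h3 h4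
    rw [h2.2.2.2.2.2.1, h3.2.2.1, h4]
  have hk : Tendsto (fun z => f (p z) * e' (q z)) l (loopNhds v.left.base) := by
    refine tendsto_loopNhds_iff.2 ⟨?_, ?_⟩
    · have := tendsto_mul (hf.comp hp) (he'.comp hq) rfl hfe
      rwa [one_mul_of_left (left_one _)] at this
    · filter_upwards [hp.eventually h, hq.eventually h', hfe] with z h2 h3 h4
      rw [left_mul, right_mul h4]
      exact ⟨h2.2.2.2.2.1.trans hb, h3.2.2.2.1⟩
  have hc := (tendsto_conj (a := proj W v) (x := v.left.base) rfl).comp hk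
  have hc' := tendsto_loopNhds_iff.1 hc
  have hcf := tendsto_mul hc'.1 (hf'.comp hq) rfl (by
    filter_upwards [hc'.2, hq.eventually h'] with z h2 h3
    exact h2.2.trans h3.2.2.2.2.1.symm)
  rw [right_proj, one_mul_of_left (left_one _)] at hcf
  refine (tendsto_br_mul_one hS hW h1 hτ (u * v) (e := fun z => e (p z)) (by
    rw [left_mul]; exact he.comp hp) (by rw [right_mul huv]; exact hcf) ?_ ?_).congr' ?_
  · filter_upwards [hp.eventually h] with z h2
    rw [left_mul]; exact h2.2.2.2.1
  · filter_upwards [hc'.2] with z h2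
    rw [right_mul huv, left_mul]; exact h2.1
  · filter_upwards [hp.eventually h, hq.eventually h', hfe, hc'.2,
      hk.eventually (eventually_br_mul_comm hW h1 v), (tendsto_loopNhds_iff.1 hk).2,
      eventually_br_mul hW (hf.comp hp) (he'.comp hq) rfl hfe (h1 _) (h1 _)
        (by rw [one_mul_of_left (left_one _)]; exact h1 _),
      eventually_br_mul hW hc'.1 (hf'.comp hq) rfl (by
        filter_upwards [hc'.2, hq.eventually h'] with z h2 h3
        exact h2.2.trans h3.2.2.2.2.1.symm) (h1 _) (h1 _)
        (by rw [right_proj, one_mul_of_left (left_one _)]; exact h1 _)]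
      with z ⟨a1, a2, a3, a4, a5, a6, a7⟩ ⟨b1, b2, b3, b4, b5, b6, b7⟩ h4 h5 h6 h7 h8 h9
    simp only [Function.comp_apply] at h5 h6 h7 h8 h9 ⊢
    conv_rhs => rw [a7, b7]
    set k := f (p z) * e' (q z)
    set c := (proj W v)⁻¹ * (k * proj W v)
    have c1 : (br W (e (p z))).right = u.left := by simp [a1, a4]
    have c2 : u.right = (br W (f (p z))).left := by simp [a5]
    have c3 : (br W (f (p z))).right = (br W (e' (q z))).left := by simp [a2, h4]
    have c4 : (br W (e' (q z))).right = v.left := by simp [b1, b4]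
    have c5 : v.right = (br W (f' (q z))).left := by simp [b5]
    have c6 : v.right = (br W c).left := by simp [h5.1]
    have c7 : (br W c).right = (br W (f' (q z))).left := by
      rw [right_br h9.1, left_br, h5.2, b5]; rfl
    rw [h9.2.2, assoc (b := u * br W (f (p z))) (by rw [left_mul, c1])
      (by rw [right_mul c2, c3, left_mul]), assoc c2 (by rw [c3, left_mul]),
      ← assoc (a := br W (f (p z))) c3 (by rw [c4, left_mul]), ← h8.2.2,
      ← assoc (a := br W k) ?_ c5, h6, assoc c6 c7, assoc huv (by rw [c6, left_mul])]
    rw [h8.2.2, right_mul c3, c4]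

theorem isTopologicalGroupoid_monodromy : IsTopologicalGroupoid (Monodromy W) where
  continuous_source := continuous_induced_rng.2
    ((IsTopologicalGroupoid.continuous_source (X := X)).comp (continuous_proj hS hW h1 hτ))
  continuous_target := continuous_induced_rng.2
    ((IsTopologicalGroupoid.continuous_target (X := X)).comp (continuous_proj hS hW h1 hτ))
  continuous_one := continuous_one_monodromy hS hW h1 hτ
  continuous_inv := continuous_inv_monodromy hS hW h1 hτ
  continuous_mul := by
    refine continuous_iff_continuousAt.2 fun p => ?_
    have := tendsto_mul_monodromy hS hW h1 hτ p.2 (l := 𝓝 p)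
      ((continuous_fst.comp continuous_subtype_val).tendsto p)
      ((continuous_snd.comp continuous_subtype_val).tendsto p) (.of_forall fun q => q.2)
    rw [mul_def p.2] at this
    exact this.congr fun q => mul_def q.2

end MonodromyTopology

/-! ### The canonical morphism is a surjective covering on stars. -/

section Covering

variable {X : Type u} [Groupoid.{v} X] [TopologicalSpace X] [TopologicalSpace (Quiver.Total X)]
  [IsTopologicalGroupoid X]

theorem continuous_left_translation {Z : Type*} [TopologicalSpace Z] (a : Quiver.Total X)
    {f : Z → Quiver.Total X} (hf : Continuous f) (h : ∀ z, (f z).left = a.right) :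
    Continuous fun z => a * f z :=
  continuous_iff_continuousAt.2 fun z => tendsto_mul tendsto_const_nhds (hf.tendsto z) (h z).symm
    (.of_forall fun z => (h z).symm)

variable {S : X → X → Quiver.Total X} {W : Set (Quiver.Total X)}
  [TopologicalSpace (Quiver.Total (Monodromy W))]
  (hS : IsLocalSection S) (hW : IsOpen W) (h1 : ∀ x : X, one x ∈ W)
  (hτ : IsLiftTopology S W)

include hS hW h1 hτ

theorem continuous_mapStar_canonical (x : Monodromy W) :
    Continuous (mapStar (canonical W) x) :=
  ((continuous_proj hS hW h1 hτ).comp continuous_subtype_val).subtype_mk _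

/-- The point `v [a⁻¹ p(v)]⁻¹` over `a` labels the sheet through `v`, and the label is locally
constant: with it fixed as `u`, both `u [a⁻¹ p(v')]` and `v'` are the local lift at `v` of `p(v')`.
-/
theorem eventually_mul_inv_br_eq {Z : Type*} {l : Filter Z} {p : Z → Quiver.Total (Monodromy W)}
    {v : Quiver.Total (Monodromy W)} {a : Quiver.Total X} (ha : a.left = v.left.base)
    (hv : a⁻¹ * proj W v ∈ W) (hp : Tendsto p l (𝓝 v)) (hl : ∀ᶠ z in l, (p z).left = v.left) :
    ∀ᶠ z in l, p z * (br W (a⁻¹ * proj W (p z)))⁻¹ = v * (br W (a⁻¹ * proj W v))⁻¹ := by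
  set d := a⁻¹ * proj W v with hd
  set u := v * (br W d)⁻¹ with hu
  have hdl : d.left = a.right := by simp [d]
  have hdr : d.right = v.right.base := by rw [hd, right_mul (by simp [ha])]; rfl
  have hvd : v.right = (br W d)⁻¹.left := by simp [hv, hdr]
  have hur : u.right.base = a.right := by rw [hu, right_mul hvd]; simp [hdl]
  have hpu : proj W u = a := by
    rw [hu, proj_mul hvd, proj_inv, proj_br hv, hd, mul_inv_rev_of (by simp [ha]), inv_inv_total,
      mul_inv_cancel_of (by simp [ha])]
  have huv : u * br W d = v := by
    rw [hu, mul_inv_mul_cancel (by simp [hv, hdr])]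
  have hpp := ((continuous_proj hS hW h1 hτ).tendsto v).comp hp
  have hf : Tendsto (fun z => a⁻¹ * proj W (p z)) l (𝓝 d) :=
    tendsto_mul tendsto_const_nhds hpp (by simp [ha]) (hl.mono fun z hz => by simp [ha, hz])
  have key := eventually_eq_localLift hS hW h1 u (e := fun _ => one u.left.base) tendsto_const_nhds
    hf (h1 _) hv rfl (by rw [hur, hdl]) (by simp) (.of_forall fun z => by simp [hur])
  filter_upwards [key, hl, hp.eventually (eventually_localLift_proj hS hW h1 hτ v),
    hf (hW.mem_nhds hv)] with z hz hzl hz' hzW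
  rw [br_one (h1 _), one_mul_of_left (by simp), one_mul_of_left (by simp), huv,
    one_mul_of_left (by simp), hpu, mul_inv_cancel_of (by simp [ha, hzl]), hz'] at hz
  rw [← mul_mul_inv_cancel (a := u) (b := br W (a⁻¹ * proj W (p z))) (by
    rw [left_br, left_mul, left_inv, ← hur]), hz]

theorem isCoveringMap_mapStar_canonical (x : Monodromy W) :
    IsCoveringMap (mapStar (canonical W) x) := by
  intro a
  set q := mapStar (canonical W) x with hq
  have hqc : Continuous q := continuous_mapStar_canonical hS hW h1 hτ x
  have hax : a.1.left = x.base := a.2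
  let U : Set (Star (X := X) ((canonical W).obj x)) := {g | a.1⁻¹ * g.1 ∈ W}
  have hU : IsOpen U := hW.preimage (continuous_left_translation a.1⁻¹ continuous_subtype_val
    fun g => g.2.trans a.2.symm)
  let I := {u : Star x // q u = a}
  -- The fibre is made discrete by decree; `to_isEvenlyCovered_preimage` passes to its subspace
  -- topology at the end.
  let _ : TopologicalSpace I := ⊥
  have : DiscreteTopology I := ⟨rfl⟩
  have hcomp : ∀ (g : Star (X := X) ((canonical W).obj x)) , a.1⁻¹.right = g.1.left := fun g =>
    a.2.trans g.2.symm
  have hproj : ∀ u : Star x, proj W u.1 = (q u).1 := fun u => rfl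
  have hproj' : ∀ u : I, proj W u.1.1 = a.1 := fun u => congrArg Subtype.val u.2
  have hur : ∀ u : I, u.1.1.right = ⟨a.1.right⟩ := fun u => by rw [← hproj' u]; rfl
  have hmem : ∀ (g : U) (u : I), proj W (u.1.1 * br W (a.1⁻¹ * g.1.1)) = g.1.1 := fun g u => by
    rw [proj_mul (by rw [hur u]; simp), proj_br g.2, hproj', mul_inv_cancel_of (hcomp g.1)]
  have hback : ∀ v : q ⁻¹' U, v.1.1.right = (br W (a.1⁻¹ * (q v.1).1))⁻¹.left := fun v => by
    rw [left_inv, right_br v.2, right_mul (hcomp _)]; rfl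
  have hret : ∀ v : q ⁻¹' U, proj W (v.1.1 * (br W (a.1⁻¹ * (q v.1).1))⁻¹) = a.1 := fun v => by
    rw [proj_mul (hback v), proj_inv, proj_br v.2, hproj, mul_inv_rev_of (hcomp _), inv_inv_total,
      mul_inv_cancel_of ((q v.1).2.trans a.2.symm)]
  let inv' : U × I → q ⁻¹' U := fun z => ⟨⟨z.2.1.1 * br W (a.1⁻¹ * z.1.1.1),
    (left_mul _ _).trans z.2.1.2⟩, by
      change a.1⁻¹ * proj W (z.2.1.1 * br W (a.1⁻¹ * z.1.1.1)) ∈ W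
      rw [hmem z.1 z.2]; exact z.1.2⟩
  let to' : q ⁻¹' U → U × I := fun v => (⟨q v.1, v.2⟩,
    ⟨⟨v.1.1 * (br W (a.1⁻¹ * (q v.1).1))⁻¹, (left_mul _ _).trans v.1.2⟩, Subtype.ext (hret v)⟩)
  have hqi : ∀ z, q (inv' z).1 = z.1.1 := fun z => Subtype.ext (hmem z.1 z.2)
  have hto : Continuous to' := by
    refine ((hqc.comp continuous_subtype_val).subtype_mk _).prodMk ?_
    refine continuous_iff_continuousAt.2 fun v => ?_
    rw [ContinuousAt, nhds_discrete I, tendsto_pure]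
    filter_upwards [eventually_mul_inv_br_eq hS hW h1 hτ (a := a.1) (v := v.1.1) (l := 𝓝 v)
      (p := fun v => v.1.1) (by rw [v.1.2]; exact hax) v.2
      ((continuous_subtype_val.comp continuous_subtype_val).tendsto v)
      (.of_forall fun v' => v'.1.2.trans v.1.2.symm)] with v' hv'
    exact Subtype.ext (Subtype.ext hv')
  have hinv : Continuous inv' := by
    refine continuous_prod_of_discrete_right.2 fun u => ?_
    refine Continuous.subtype_mk (Continuous.subtype_mk ?_ _) _
    refine continuous_iff_continuousAt.2 fun g => ?_
    refine tendsto_mul_br hS hW h1 hτ u.1.1 ?_ g.2 ?_ ?_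
    · exact (continuous_left_translation a.1⁻¹ (continuous_subtype_val.comp continuous_subtype_val)
        fun g => (hcomp g.1).symm).tendsto g
    · rw [hur u]; simp
    · rw [hur u]; simp
  let H : q ⁻¹' U ≃ₜ U × I :=
    { toFun := to'
      invFun := inv'
      left_inv := fun v => Subtype.ext (Subtype.ext (mul_inv_mul_cancel (hback v)))
      right_inv := fun z => by
        refine Prod.ext (Subtype.ext (hqi z)) (Subtype.ext (Subtype.ext ?_))
        change (z.2.1.1 * br W (a.1⁻¹ * z.1.1.1)) * (br W (a.1⁻¹ * (q (inv' z).1).1))⁻¹ = z.2.1.1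
        rw [hqi, mul_mul_inv_cancel (by rw [hur]; simp)]
      continuous_toFun := hto
      continuous_invFun := hinv }
  have : IsEvenlyCovered q a I := ⟨inferInstance, U, by
    change a.1⁻¹ * a.1 ∈ W
    rw [inv_mul_self_total]; exact h1 _, hU, hU.preimage hqc, H, fun v => rfl⟩
  exact this.to_isEvenlyCovered_preimage

/-- If `a⁻¹ p(v) ∈ W` then `v [a⁻¹ p(v)]⁻¹` lies over `a`, so the complement of the image is open.
-/
theorem surjective_mapStar_canonical (x : Monodromy W)
    [PreconnectedSpace (Star (X := X) ((canonical W).obj x))] :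
    Function.Surjective (mapStar (canonical W) x) := by
  have hc := isCoveringMap_mapStar_canonical hS hW h1 hτ x
  set q := mapStar (canonical W) x with hq
  have hopen : IsOpen (Set.range q) := hc.isOpenMap.isOpen_range
  have hclosed : IsClosed (Set.range q) := by
    rw [← isOpen_compl_iff, isOpen_iff_mem_nhds]
    intro a ha
    have hg : Continuous fun g : Star (X := X) ((canonical W).obj x) => a.1⁻¹ * g.1 :=
      continuous_left_translation a.1⁻¹ continuous_subtype_val fun g => g.2.trans a.2.symm
    filter_upwards [(hW.preimage hg).mem_nhds (show a.1⁻¹ * a.1 ∈ W by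
      rw [inv_mul_self_total]; exact h1 _)] with g hgW
    rintro ⟨v, rfl⟩
    rw [Set.mem_preimage] at hgW
    have hcomp : a.1⁻¹.right = (q v).1.left := a.2.trans (q v).2.symm
    have hback : v.1.right = (br W (a.1⁻¹ * (q v).1))⁻¹.left := by
      rw [left_inv, right_br hgW, right_mul hcomp]; rfl
    refine ha ⟨⟨v.1 * (br W (a.1⁻¹ * (q v).1))⁻¹, (left_mul _ _).trans v.2⟩, Subtype.ext ?_⟩
    change proj W (v.1 * (br W (a.1⁻¹ * (q v).1))⁻¹) = a.1
    rw [proj_mul hback, proj_inv, proj_br hgW, show proj W v.1 = (q v).1 from rfl,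
      mul_inv_rev_of hcomp, inv_inv_total, mul_inv_cancel_of ((q v).2.trans a.2.symm)]
  have hne : (Set.range q).Nonempty := ⟨_, ⟨⟨one x, rfl⟩, rfl⟩⟩
  exact Set.range_eq_univ.1 (IsClopen.eq_univ ⟨hclosed, hopen⟩ hne)

end Covering

/-! ### Path lifting over liftable sets. -/

section Lifting

variable {E B : Type*} [TopologicalSpace E] [TopologicalSpace B] {q : E → B}

/-- Used in `simplyConnectedSpace_star`, where nearby parameters must be joined inside an open set.
-/
instance : LocallyPathConnectedSpace unitInterval :=
  (isQuotientMap_projIcc (h := zero_le_one (α := ℝ))).locallyPathConnectedSpace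

/-- A covering map is injective on the path components of the preimage of a liftable set. -/
theorem IsLiftable.eq_of_joinedIn {R : Set B} (hR : IsLiftable R) (hq : IsCoveringMap q)
    {e e' : E} (h : JoinedIn (q ⁻¹' R) e e') (he : q e = q e') : e = e' := by
  obtain ⟨δ, hδ⟩ := h
  have hb : q e ∈ R := by simpa using hδ 0
  -- The projected path is a loop in `R`, null-homotopic in `B`, so its lift ends where the constant
  -- lift does.
  let γ : Path (⟨q e, hb⟩ : R) ⟨q e, hb⟩ :=
    { toFun := fun t => ⟨q (δ t), hδ t⟩
      continuous_toFun := (hq.continuous.comp δ.continuous).subtype_mk _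
      source' := by simp
      target' := by simp [he] }
  have hγ := hR.null_homotopic _ γ
  have h0 : (γ.map continuous_subtype_val).toContinuousMap 0 = q e := by simp
  have h1 := hq.liftPath_apply_one_eq_of_homotopicRel hγ e h0 rfl
  have h2 : δ.toContinuousMap = hq.liftPath (γ.map continuous_subtype_val).toContinuousMap e h0 :=
    (hq.eq_liftPath_iff' h0).2 ⟨rfl, δ.source⟩
  have h3 : ContinuousMap.const unitInterval e =
      hq.liftPath (Path.refl (q e)).toContinuousMap e rfl :=
    (hq.eq_liftPath_iff' rfl).2 ⟨rfl, rfl⟩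
  have h1 : δ.toContinuousMap 1 = e := by
    rw [h2, h1, ← h3]; rfl
  rw [← h1]
  exact δ.target

theorem exists_joinedIn_lift (hq : IsCoveringMap q) {R : Set B} {b : B} {e : E}
    (h : JoinedIn R (q e) b) : ∃ e', q e' = b ∧ JoinedIn (q ⁻¹' R) e e' := by
  obtain ⟨δ, hδ⟩ := h
  have hl := hq.liftPath_lifts δ.toContinuousMap e δ.source
  have h0 := hq.liftPath_zero δ.toContinuousMap e δ.source
  set Γ := hq.liftPath δ.toContinuousMap e δ.source
  refine ⟨Γ 1, (congrFun hl 1).trans δ.target, ⟨Γ, h0, rfl⟩, fun t => ?_⟩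
  have : q (Γ t) = δ t := congrFun hl t
  exact (congrArg (· ∈ R) this).mpr (hδ t)

end Lifting

section Square

variable {X : Type u} [Groupoid.{v} X] {V W : Set (Quiver.Total X)}

theorem mul_mem_of_square_subset (hWV : square W ⊆ V) {a b : Quiver.Total X} (ha : a ∈ W)
    (hb : b ∈ W) (h : a.right = b.left) : a * b ∈ V :=
  hWV ⟨a, b, h, ha, hb, mul_def h⟩

theorem subset_of_square_subset (h1 : ∀ x : X, one x ∈ W) (hWV : square W ⊆ V) : W ⊆ V := fun a ha => by
  have := mul_mem_of_square_subset hWV ha (h1 a.right) rfl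
  rwa [mul_one_of_right rfl] at this

end Square

/-! ### Moving points of a covering of a star by elements of `W`. -/

section ThinLift

variable {X : Type u} [Groupoid.{v} X] {x : X} {E : Type*}
  {q : E → Star x} {V W : Set (Quiver.Total X)}

/-- The part of a covering of a star over the left translate `c R`. -/
def overSet (q : E → Star x) (R : Set (Quiver.Total X)) (c : Quiver.Total X) : Set E :=
  {e | c⁻¹ * (q e).1 ∈ R}

theorem mem_over_self (h1 : ∀ x : X, one x ∈ W) (e : E) : e ∈ overSet q W (q e).1 := by
  change (q e).1⁻¹ * (q e).1 ∈ W
  rw [inv_mul_self_total]; exact h1 _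

variable [TopologicalSpace E]

/-- The point `e'` is joined to `e` over `q(e)R`, and lies over `q(e)w`. -/
def IsThinLift (q : E → Star x) (R : Set (Quiver.Total X)) (w : Quiver.Total X) (e e' : E) : Prop :=
  (q e').1 = (q e).1 * w ∧ JoinedIn (overSet q R (q e).1) e e'

theorem IsThinLift.mono {w : Quiver.Total X} {e e' : E} (h : IsThinLift q W w e e') (hWV : W ⊆ V) :
    IsThinLift q V w e e' :=
  ⟨h.1, h.2.mono fun _ he => hWV he⟩

/-- The second path lies over `q(e) w W`, which is inside `q(e) W² ⊆ q(e) V`. -/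
theorem IsThinLift.trans (hWV : square W ⊆ V) {w w' : Quiver.Total X} {e e' e'' : E} (hw : w ∈ W)
    (h1 : ∀ x : X, one x ∈ W)
    (he : (q e).1.right = w.left) (hww' : w.right = w'.left)
    (h : IsThinLift q W w e e') (h' : IsThinLift q W w' e' e'') :
    IsThinLift q V (w * w') e e'' := by
  refine ⟨by rw [h'.1, h.1, assoc he hww'],
    (h.mono (subset_of_square_subset h1 hWV)).2.trans (h'.2.mono fun g hg => ?_)⟩
  have hg' : ((q e).1 * w)⁻¹ * (q g).1 ∈ W := by
    have : (q e').1⁻¹ * (q g).1 ∈ W := hg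
    rwa [h.1] at this
  have hl : (q e).1.left = (q g).1.left := (q e).2.trans (q g).2.symm
  have h2 := mul_mem_of_square_subset hWV hw hg' (by simp [he])
  rw [mul_inv_rev_of he, assoc (by simp [he]) (by simp [hl]), mul_inv_cancel_of (by simp [he])] at h2
  exact h2

end ThinLift

section StarCovering

variable {X : Type u} [Groupoid.{v} X] [TopologicalSpace X] [TopologicalSpace (Quiver.Total X)]
  [IsTopologicalGroupoid X]

/-- Left translation by `c⁻¹`, as a homeomorphism of stars. -/
noncomputable def translation {x : X} (c : Star x) : Star x ≃ₜ Star c.1.right where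
  toFun g := ⟨c.1⁻¹ * g.1, left_mul _ _⟩
  invFun g := ⟨c.1 * g.1, (left_mul _ _).trans c.2⟩
  left_inv g := Subtype.ext (mul_inv_cancel_of (c.2.trans g.2.symm))
  right_inv g := Subtype.ext (inv_mul_cancel_of g.2.symm)
  continuous_toFun := (continuous_left_translation _ continuous_subtype_val
    fun g => g.2.trans c.2.symm).subtype_mk _
  continuous_invFun := (continuous_left_translation _ continuous_subtype_val
    fun g => g.2).subtype_mk _

variable {x : X} {E : Type*} [TopologicalSpace E] {q : E → Star x} {V W : Set (Quiver.Total X)}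

/-- Translation by `c⁻¹` turns `q` into a covering of the star at the final point of `c`, where `V`
is liftable. -/
theorem eq_of_joinedIn_over (hq : IsCoveringMap q) (hV : ∀ x : X, IsLiftable (starPart V x))
    (c : Star x) {e e' : E} (h : JoinedIn (overSet q V c.1) e e') (he : q e = q e') : e = e' :=
  (hV c.1.right).eq_of_joinedIn (hq.homeomorph_comp (translation c)) h
    (congrArg (translation c) he)

theorem exists_joinedIn_over (hq : IsCoveringMap q) (hW : ∀ x : X, IsPathConnected (starPart W x))
    (c : Star x) {e : E} (he : e ∈ overSet q W c.1) (b : Star x) (hb : c.1⁻¹ * b.1 ∈ W) :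
    ∃ e', q e' = b ∧ JoinedIn (overSet q W c.1) e e' := by
  obtain ⟨e', h1, h2⟩ := exists_joinedIn_lift (e := e) (hq.homeomorph_comp (translation c))
    ((hW c.1.right).joinedIn _ he (translation c b) hb)
  exact ⟨e', (translation c).injective h1, h2⟩

variable (hq : IsCoveringMap q) (h1 : ∀ x : X, one x ∈ W)
  (hW : ∀ x : X, IsPathConnected (starPart W x)) (hV : ∀ x : X, IsLiftable (starPart V x))

include hq h1 hW in
theorem exists_isThinLift {w : Quiver.Total X} (hw : w ∈ W) {e : E} (he : (q e).1.right = w.left) :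
    ∃ e', IsThinLift q W w e e' := by
  obtain ⟨e', h, h'⟩ := exists_joinedIn_over hq hW (q e) (mem_over_self h1 e)
    ⟨(q e).1 * w, (left_mul _ _).trans (q e).2⟩ (by rwa [inv_mul_cancel_of he])
  exact ⟨e', congrArg Subtype.val h, h'⟩

include hq hV in
theorem IsThinLift.eq {w : Quiver.Total X} {e e' e'' : E} (h : IsThinLift q V w e e')
    (h' : IsThinLift q V w e e'') : e' = e'' :=
  eq_of_joinedIn_over hq hV (q e) (h.2.symm.trans h'.2) (Subtype.ext (h.1.trans h'.1.symm))

include hq hV in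
theorem IsThinLift.eq_left {w : Quiver.Total X} {e e' e'' : E} (h : IsThinLift q V w e e'')
    (h' : IsThinLift q V w e' e'') (hw : (q e).1.right = w.left) (hw' : (q e').1.right = w.left) :
    e = e' := by
  have hqq : q e = q e' :=
    Subtype.ext (mul_right_cancel_of hw hw' (h.1.symm.trans h'.1))
  have h2 := h'.2
  rw [← hqq] at h2
  exact eq_of_joinedIn_over hq hV (q e) (h.2.trans h2.symm) hqq

include hq hW in
-- Since `w⁻¹` need not lie in `W`, the path is lifted from `e'` over `cW` with `c = q(e') w⁻¹`, and
-- ends over `c`.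
theorem exists_isThinLift_left (h1 : ∀ x : X, one x ∈ W) {w : Quiver.Total X} (hw : w ∈ W) {e' : E}
    (he : (q e').1.right = w.right) :
    ∃ e, (q e).1.right = w.left ∧ IsThinLift q W w e e' := by
  let c : Star x := ⟨(q e').1 * w⁻¹, (left_mul _ _).trans (q e').2⟩
  have hc : c.1 * w = (q e').1 := mul_inv_mul_cancel he
  have hcr : c.1.right = w.left := by
    change ((q e').1 * w⁻¹).right = _
    rw [right_mul (by simpa), right_inv]
  obtain ⟨e, h, h'⟩ := exists_joinedIn_over hq hW c (e := e') (by
      change c.1⁻¹ * (q e').1 ∈ W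
      rwa [← hc, inv_mul_cancel_of hcr]) c (by rw [inv_mul_self_total]; exact h1 _)
  refine ⟨e, by rw [h, hcr], by rw [h, hc], ?_⟩
  rw [h]; exact h'.symm

end StarCovering

/-- The groupoid of types and bijections. -/
structure TypeEquivs : Type (w + 1) where
  carrier : Type w

instance : Groupoid TypeEquivs.{w} where
  Hom A B := A.carrier ≃ B.carrier
  id A := Equiv.refl A.carrier
  comp f g := f.trans g
  inv f := f.symm
  inv_comp f := f.symm_trans_self
  comp_inv f := f.self_trans_symm

/-! ### The action of the monodromy groupoid on a covering of a star. -/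

section Action

variable {X : Type u} [Groupoid.{v} X] [TopologicalSpace X] [TopologicalSpace (Quiver.Total X)]
  [IsTopologicalGroupoid X] {x : X} {E : Type*} [TopologicalSpace E] {q : E → Star x}
  {V W : Set (Quiver.Total X)}

/-- The points of a covering of a star which lie over the elements with final point `y`. -/
abbrev EndFibre (q : E → Star x) (y : X) := {e : E // (q e).1.right = y}

theorem exists_equiv_isThinLift (hq : IsCoveringMap q) (h1 : ∀ x : X, one x ∈ W)
    (hW : ∀ x : X, IsPathConnected (starPart W x)) (hV : ∀ x : X, IsLiftable (starPart V x))
    (hWV : W ⊆ V) {w : Quiver.Total X} (hw : w ∈ W) :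
    ∃ φ : EndFibre q w.left ≃ EndFibre q w.right, ∀ e, IsThinLift q W w e.1 (φ e).1 := by
  have hex : ∀ e : EndFibre q w.left, ∃ e' : EndFibre q w.right, IsThinLift q W w e.1 e'.1 :=
    fun e => by
      obtain ⟨e', he'⟩ := exists_isThinLift hq h1 hW hw e.2
      exact ⟨⟨e', by rw [he'.1, right_mul e.2]⟩, he'⟩
  choose φ hφ using hex
  refine ⟨Equiv.ofBijective φ ⟨fun e e' h => ?_, fun e' => ?_⟩, hφ⟩
  · have h2 := hφ e'
    rw [← h] at h2
    exact Subtype.ext (((hφ e).mono hWV).eq_left hq hV (h2.mono hWV) e.2 e'.2)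
  · obtain ⟨e, he, h⟩ := exists_isThinLift_left hq hW h1 hw e'.2
    exact ⟨⟨e, he⟩, Subtype.ext (((hφ ⟨e, he⟩).mono hWV).eq hq hV (h.mono hWV))⟩

/-- The elements of the star of the monodromy groupoid act on a point of a covering of the star
over the identity. -/
theorem exists_lift_star (hq : IsCoveringMap q) (h1 : ∀ x : X, one x ∈ W)
    (hW : ∀ x : X, IsPathConnected (starPart W x)) (hV : ∀ x : X, IsLiftable (starPart V x))
    (hWV : square W ⊆ V) {e₀ : E} (he₀ : (q e₀).1 = one x) :
    ∃ Θ : Star (⟨x⟩ : Monodromy W) → E, (∀ u, (q (Θ u)).1 = proj W u.1) ∧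
      ∀ (u v : Star (⟨x⟩ : Monodromy W)), ∀ w ∈ W, u.1.right = ⟨w.left⟩ → v.1 = u.1 * br W w →
        JoinedIn (overSet q V (proj W u.1)) (Θ u) (Θ v) := by
  have hWV' := subset_of_square_subset h1 hWV
  choose φ hφ using fun (w : Quiver.Total X) (hw : w ∈ W) =>
    exists_equiv_isThinLift hq h1 hW hV hWV' hw
  obtain ⟨Φ, hΦ1, hΦ2, hΦ3⟩ := Monodromy.exists_lift (W := W) (H := TypeEquivs)
    (fun y => ⟨EndFibre q y⟩) (fun {y z} a ha => φ ⟨y, z, a⟩ ha) (by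
      -- Both sides are thin lifts over `V` of the same element `ab`, and such lifts are unique.
      intro y z t a b ha hb hab
      refine Equiv.ext fun e => Subtype.ext ?_
      have h2 := IsThinLift.trans hWV ha h1 e.2 rfl (hφ _ ha e) (hφ _ hb _)
      rw [mk_mul_mk] at h2
      exact h2.eq hq hV ((hφ _ hab e).mono hWV'))
  let Ψ : ∀ u : Quiver.Total (Monodromy W), EndFibre q u.left.base ≃ EndFibre q u.right.base :=
    fun u => Φ u.hom
  have hmul : ∀ {y z t : Monodromy W} (f : y ⟶ z) (g : z ⟶ t) (e : EndFibre q y.base),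
      Ψ ⟨y, t, f ≫ g⟩ e = Ψ ⟨z, t, g⟩ (Ψ ⟨y, z, f⟩ e) := fun f g e =>
    Equiv.congr_fun (hΦ2 f g) e
  have hone : ∀ (y : Monodromy W) (e : EndFibre q y.base), Ψ (one y) e = e := fun y e =>
    Equiv.congr_fun (hΦ1 y) e
  have hbr : ∀ {y z : X} (a : y ⟶ z) (ha : (⟨y, z, a⟩ : Quiver.Total X) ∈ W) (e : EndFibre q y),
      Ψ ⟨⟨y⟩, ⟨z⟩, Monodromy.ofFree (bracket W a ha)⟩ e = φ ⟨y, z, a⟩ ha e := fun a ha e =>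
    Equiv.congr_fun (hΦ3 a ha) e
  have hproj : ∀ (u : Quiver.Total (Monodromy W)) (e : EndFibre q u.left.base),
      (q (Ψ u e).1).1 = (q e.1).1 * proj W u := by
    intro u
    induction u using Monodromy.induction with
    | one y =>
      intro e
      have h0 : (q e.1).1 * one y.base = (q e.1).1 := mul_one_of_right e.2
      rw [proj_one, h0]
      exact congrArg (fun z => (q z.1).1) (hone y e)
    | mul u v h hu hv =>
      obtain ⟨y, z, f⟩ := u
      obtain ⟨_, t, g⟩ := v
      obtain rfl : z = _ := h
      rw [proj_mul rfl, mk_mul_mk]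
      intro e
      rw [hmul, hv, hu, assoc e.2 rfl]
    | inv u hu =>
      obtain ⟨y, z, f⟩ := u
      intro e
      change EndFibre q z.base at e
      have h2 := hu (Ψ ⟨z, y, Groupoid.inv f⟩ e)
      have h3 : Ψ ⟨y, z, f⟩ (Ψ ⟨z, y, Groupoid.inv f⟩ e) = e :=
        (hmul _ _ e).symm.trans (by rw [Groupoid.inv_comp]; exact hone z e)
      rw [h3] at h2
      rw [proj_inv, h2, mul_mul_inv_cancel (Ψ ⟨z, y, Groupoid.inv f⟩ e).2]
      rfl
    | br a ha =>
      obtain ⟨y, z, a⟩ := a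
      rw [proj_br ha, br_mk ha]
      intro e
      rw [hbr a ha e]
      exact (hφ _ ha e).1
  have hbase : ∀ u : Star (⟨x⟩ : Monodromy W), (q e₀).1.right = u.1.left.base := fun u => by
    rw [he₀, u.2]; rfl
  refine ⟨fun u => (Ψ u.1 ⟨e₀, hbase u⟩).1, fun u => ?_, ?_⟩
  · rw [hproj, he₀, one_mul_of_left (congrArg Monodromy.base u.2)]
  · rintro ⟨⟨x', ⟨y⟩, f⟩, hx⟩ ⟨v, hv⟩ ⟨y', z, a⟩ hw huw huv
    obtain rfl : x' = ⟨x⟩ := hx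
    obtain rfl : y = y' := congrArg Monodromy.base huw
    change v = _ at huv
    rw [br_mk hw, mk_mul_mk] at huv
    subst huv
    have h2 := (hφ _ hw (Ψ ⟨⟨x⟩, ⟨y⟩, f⟩ ⟨e₀, by rw [he₀]; rfl⟩)).mono hWV'
    have h3 := h2.2
    have hp : (q e₀).1 * proj W (⟨⟨x⟩, ⟨y⟩, f⟩ : Quiver.Total (Monodromy W)) =
        proj W ⟨⟨x⟩, ⟨y⟩, f⟩ := by
      rw [he₀]; exact one_mul_of_left rfl
    rw [(hproj _ _).trans hp] at h3
    have h4 := hmul f (Monodromy.ofFree (bracket W a hw)) ⟨e₀, by rw [he₀]; rfl⟩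
    rw [hbr a hw] at h4
    change JoinedIn _ _ (Ψ ⟨⟨x⟩, ⟨z⟩, f ≫ Monodromy.ofFree (bracket W a hw)⟩ ⟨e₀, _⟩).1
    rw [h4]
    exact h3

end Action

/-! ### Simple connectedness of the stars. -/

section UniversalCovering

variable {X : Type u} [Groupoid.{v} X] [TopologicalSpace X] [TopologicalSpace (Quiver.Total X)]
  [IsTopologicalGroupoid X] {S : X → X → Quiver.Total X} {V W : Set (Quiver.Total X)}
  [TopologicalSpace (Quiver.Total (Monodromy W))]
  (hS : IsLocalSection S) (hW : IsOpen W) (h1 : ∀ x : X, one x ∈ W)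
  (hτ : IsLiftTopology S W) (hWp : ∀ x : X, IsPathConnected (starPart W x))

include hS hW h1 hτ hWp

/-- For a generator, `t ↦ v [γ t]` is a path, with `γ` running in `W` from an identity to `w`.
Quantifying over `v` lets products concatenate, and the inverse case use the point `v u⁻¹`. -/
theorem joinedIn_star_mul (u : Quiver.Total (Monodromy W)) :
    ∀ v : Quiver.Total (Monodromy W), v.right = u.left →
      JoinedIn {w | w.left = v.left} v (v * u) := by
  induction u using Monodromy.induction with
  | one y =>
    intro v hv
    rw [mul_one_of_right (y := y) hv]
    exact JoinedIn.refl rfl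
  | mul u u' h hu hu' =>
    intro v hv
    rw [left_mul] at hv
    have h2 := hu' (v * u) (by rw [right_mul hv, h])
    rw [left_mul, assoc hv h] at h2
    exact (hu v hv).trans h2
  | inv u hu =>
    intro v hv
    have h2 := hu (v * u⁻¹) (by rw [right_mul hv]; rfl)
    rw [left_mul, mul_inv_mul_cancel hv] at h2
    exact h2.symm
  | br w hw =>
    intro v hv
    rw [left_br] at hv
    obtain ⟨γ, hγ⟩ := (hWp w.left).joinedIn ⟨one w.left, rfl⟩ (h1 _) ⟨w, rfl⟩ hw
    have hc : Continuous fun t => v * br W (γ t).1 := by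
      refine continuous_iff_continuousAt.2 fun t => ?_
      refine tendsto_mul_br hS hW h1 hτ v
        ((continuous_subtype_val.comp γ.continuous).tendsto t) (hγ t) ?_ (.of_forall fun s => ?_)
      · rw [hv]; exact (γ t).2
      · rw [hv]; exact (γ s).2
    refine ⟨⟨⟨_, hc⟩, ?_, ?_⟩, fun t => left_mul _ _⟩
    · change v * br W (γ 0).1 = v
      rw [γ.source, br_one (h1 _), mul_one_of_right hv]
    · change v * br W (γ 1).1 = _
      rw [γ.target]

theorem pathConnectedSpace_star (x : Monodromy W) : PathConnectedSpace (Star x) := by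
  refine isPathConnected_iff_pathConnectedSpace.1
    (show IsPathConnected {w : Quiver.Total (Monodromy W) | w.left = x} from
      ⟨one x, rfl, fun {u} hu => ?_⟩)
  have := joinedIn_star_mul hS hW h1 hτ hWp u (one x) hu.symm
  rwa [one_mul_of_left hu] at this

theorem simplyConnectedSpace_star (hV : ∀ x : X, IsLiftable (starPart V x)) (hWV : square W ⊆ V)
    (x : X) (hG : HasUniversalCovering (Star x)) :
    SimplyConnectedSpace (Star (⟨x⟩ : Monodromy W)) := by
  obtain ⟨E, _, q, hq, hqs, hE⟩ := hG
  refine simply_connected_iff_loops_nullhomotopic.2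
    ⟨pathConnectedSpace_star hS hW h1 hτ hWp ⟨x⟩, fun u γ => ?_⟩
  have hWV' := subset_of_square_subset h1 hWV
  obtain ⟨e₀, he₀⟩ := hqs ⟨one x, rfl⟩
  obtain ⟨Θ, hΘ, hΘ'⟩ := exists_lift_star hq h1 hWp hV hWV (congrArg Subtype.val he₀)
  have hpc : IsCoveringMap (mapStar (canonical W) ⟨x⟩) :=
    isCoveringMap_mapStar_canonical hS hW h1 hτ ⟨x⟩
  let p : Star (⟨x⟩ : Monodromy W) → Star x := mapStar (canonical W) ⟨x⟩
  change IsCoveringMap p at hpc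
  have hqΘ : ∀ u, q (Θ u) = p u := fun u => Subtype.ext (hΘ u)
  let pγ : C(unitInterval, Star x) := ⟨p ∘ γ, hpc.continuous.comp γ.continuous⟩
  have hpγ0 : pγ 0 = q (Θ u) := by
    rw [hqΘ]; exact congrArg p γ.source
  let Γ := hq.liftPath pγ (Θ u) hpγ0
  have hΓ : ∀ t, q (Γ t) = p (γ t) := congrFun (hq.liftPath_lifts pγ (Θ u) hpγ0)
  have hΓ0 : Γ 0 = Θ u := hq.liftPath_zero pγ (Θ u) hpγ0
  -- Continuity of `Θ` is not needed: the truth value of the equality is locally constant in `t`,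
  -- and it holds at `0`.
  have hloc : IsLocallyConstant fun t => Γ t = Θ (γ t) := by
    refine (IsLocallyConstant.iff_eventually_eq _).2 fun t => ?_
    let c : Star x := p (γ t)
    have hcont : Continuous fun s => c.1⁻¹ * (p (γ s)).1 :=
      continuous_left_translation c.1⁻¹ (continuous_subtype_val.comp pγ.continuous)
        fun s => (p (γ s)).2.trans c.2.symm
    have hself : c.1⁻¹ * (p (γ t)).1 ∈ W := by
      rw [inv_mul_self_total]; exact h1 _
    filter_upwards [pathComponentIn_mem_nhds ((hW.preimage hcont).mem_nhds hself),
      eventually_mul_inv_br_eq hS hW h1 hτ (a := c.1) (v := (γ t).1) (l := 𝓝 t)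
        (p := fun s => (γ s).1) rfl hself
        ((continuous_subtype_val.comp γ.continuous).tendsto t)
        (.of_forall fun s => (γ s).2.trans (γ t).2.symm)] with s hs hs'
    have hsW : c.1⁻¹ * (p (γ s)).1 ∈ W := (pathComponentIn_subset hs :)
    have hcs : c.1⁻¹.right = (p (γ s)).1.left := c.2.trans (p (γ s)).2.symm
    have hΓj : JoinedIn (overSet q V c.1) (Γ t) (Γ s) := by
      have hj : JoinedIn ((fun s => c.1⁻¹ * (p (γ s)).1) ⁻¹' W) t s := hs
      refine (hj.map Γ.continuous).mono ?_
      rintro _ ⟨r, hr, rfl⟩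
      change c.1⁻¹ * (q (Γ r)).1 ∈ V
      rw [hΓ]
      exact hWV' hr
    have hΘj : JoinedIn (overSet q V c.1) (Θ (γ t)) (Θ (γ s)) := by
      refine hΘ' (γ t) (γ s) _ hsW (by rw [left_mul]; rfl) ?_
      have h2 : (γ t).1 * (br W (c.1⁻¹ * proj W (γ t).1))⁻¹ = (γ t).1 := by
        rw [show c.1⁻¹ * proj W (γ t).1 = one c.1.right from inv_mul_self_total c.1,
          br_one (h1 _), inv_one_total]
        exact mul_one_of_right rfl
      rw [h2] at hs'
      rw [← hs']
      exact (mul_inv_mul_cancel (by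
        exact (congrArg Monodromy.mk (right_mul hcs)).symm.trans (right_br hsW).symm)).symm
    have hqs : q (Γ s) = q (Θ (γ s)) := by rw [hΓ, hqΘ]
    have hqt : q (Γ t) = q (Θ (γ t)) := by rw [hΓ, hqΘ]
    -- Agreement at one of `s`, `t` joins the two points at the other over `cV`; they have the same
    -- projection, so they coincide.
    refine propext ⟨fun h => ?_, fun h => ?_⟩
    · rw [← h] at hΘj
      exact eq_of_joinedIn_over hq hV c (hΓj.trans hΘj.symm) hqt
    · rw [← h] at hΘj
      exact eq_of_joinedIn_over hq hV c (hΓj.symm.trans hΘj) hqs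
  have hΓ1 : Γ 1 = Θ u := by
    have h2 := hloc.apply_eq_of_preconnectedSpace 0 1
    have h0 : Γ 0 = Θ (γ 0) := by rw [hΓ0, γ.source]
    have h3 : Γ 1 = Θ (γ 1) := h2.mp h0
    rw [h3, γ.target]
  let δ : Path (Θ u) (Θ u) := ⟨Γ, hΓ0, hΓ1⟩
  have hδ : δ.toContinuousMap.HomotopicRel (Path.refl (Θ u)).toContinuousMap {0, 1} :=
    SimplyConnectedSpace.paths_homotopic δ (Path.refl (Θ u))
  -- Homotopy relative to the end points is tested after projecting, both for `p` and for `q`, and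
  -- `p γ = q Γ`.
  refine (hpc.homotopicRel_iff_comp ⟨0, .inl rfl, by simp⟩).2 ?_
  have h2 := (hq.homotopicRel_iff_comp ⟨0, .inl rfl, by simp⟩).1 hδ
  have h3 : ContinuousMap.comp ⟨q, hq.continuous⟩ δ.toContinuousMap =
      ContinuousMap.comp ⟨p, hpc.continuous⟩ γ.toContinuousMap := ContinuousMap.ext hΓ
  have h4 : ContinuousMap.comp ⟨q, hq.continuous⟩ (Path.refl (Θ u)).toContinuousMap =
      ContinuousMap.comp ⟨p, hpc.continuous⟩ (Path.refl u).toContinuousMap :=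
    ContinuousMap.ext fun _ => hqΘ u
  rwa [h3, h4] at h2

end UniversalCovering

end TopGpd

theorem mainTheorem2 {X : Type u} [Groupoid.{v} X] [TopologicalSpace X]
    [TopologicalSpace (Quiver.Total X)] [TopGpd.IsTopologicalGroupoid X]
    {ι : Type w} (T : TopGpd.CompatibleLocalSections X ι)
    (hG : ∀ x : X, TopGpd.HasUniversalCovering (TopGpd.Star x))
    (W V : Set (Quiver.Total X)) (hW : IsOpen W) (hV : IsOpen V)
    (hW_one : ∀ x : X, TopGpd.one x ∈ W) (hV_one : ∀ x : X, TopGpd.one x ∈ V)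
    (hW_path : ∀ x : X, IsPathConnected (TopGpd.starPart W x))
    (hWV : TopGpd.square W ⊆ V)
    (hV_lift : ∀ x : X, TopGpd.IsLiftable (TopGpd.starPart V x))
    (hTW : ∀ i, ∀ x ∈ T.U i, ∀ y ∈ T.U i, T.s i x y ∈ W) :
    ∃ _ : TopologicalSpace (Quiver.Total (TopGpd.Monodromy W)),
      TopGpd.IsTopologicalGroupoid (TopGpd.Monodromy W) ∧
      ∀ x : TopGpd.Monodromy W,
        TopGpd.IsUniversalCovering (TopGpd.mapStar (TopGpd.canonical W) x) := by
  obtain ⟨S, hS⟩ := T.exists_isLocalSection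
  refine ⟨TopGpd.monodromyTopology S W, ?_⟩
  let _ := TopGpd.monodromyTopology S W
  have hτ : TopGpd.IsLiftTopology S W := TopGpd.nhds_monodromy hS hW hW_one
  refine ⟨TopGpd.isTopologicalGroupoid_monodromy hS hW hW_one hτ, fun x => ?_⟩
  -- The star is the image of a simply connected space.
  have : PreconnectedSpace (TopGpd.Star (X := X) ((TopGpd.canonical W).obj x)) := by
    obtain ⟨E, _, q, hq, hqs, hE⟩ := hG x.base
    exact ⟨hqs.range_eq ▸ isPreconnected_range hq.continuous⟩
  exact ⟨TopGpd.isCoveringMap_mapStar_canonical hS hW hW_one hτ x,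
    TopGpd.surjective_mapStar_canonical hS hW hW_one hτ x,
    TopGpd.simplyConnectedSpace_star hS hW hW_one hτ hW_path hV_lift hWV x.base (hG x.base)⟩
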